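/- Let $\boldsymbol\beta=\{\beta_n\}_{n\in\mathbb N}$ be a sequence in $[-1,\infty)$, and put $H=\{n:\beta_n=-1\}$ and $B=\{n:\beta_n\neq-1\}$. Let $A^2_{\boldsymbol\beta}$ be the Hilbert space of all series $G=\sum_\alpha c_\alpha\zeta^\alpha$ in the variables $\zeta_1,\zeta_2,\dots$, where $\alpha$ runs over the finitely supported sequences of nonnegative integers, with $$\|G\|^2=\sum_\alpha|c_\alpha|^2\omega_\alpha<\infty,\qquad \omega_\alpha=\prod_n\frac{\alpha_n!\,\Gamma(\beta_n+2)}{\Gamma(\alpha_n+\beta_n+2)}.$$ The ring $\mathcal P_\infty$ of complex polynomials in the variables $\zeta_1,\zeta_2,\dots$ acts on $A^2_{\boldsymbol\beta}$ by multiplication. A submodule of $A^2_{\boldsymbol\beta}$ is a closed subspace invariant under this action, and $[G]$ denotes the submodule generated by $G$. Two submodules $M,N$ are unitarily equivalent if there is a unitary map $U$ of $M$ onto $N$ with $U(ph)=p\,Uh$ for all $p\in\mathcal P_\infty$ and $h\in M$. The unitary orbit $\mathrm{orb}_u(M)$ is the set of all submodules of $A^2_{\boldsymbol\beta}$ that are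 unitarily equivalent to $M$. Let $H^2(\mathbb D_2^H)$ be the space of all $F\in A^2_{\boldsymbol\beta}$ that involve only the variables $\zeta_n$ with $n\in H$. Such an $F$ is a function on $\mathbb D_2^H=\{\zeta\in\ell^2: |\zeta_n|<1 \text{ for all } n,\ \zeta_n=0 \text{ for } n\notin H\}$, and it has a boundary function $F^*\in L^2(\mathbb T^H,\sigma_H)$, where $\sigma_H$ is the normalized Haar measure of the torus $\mathbb T^H$: the map $F\mapsto F^*$ is the linear isometry that sends each monomial to its restriction to $\mathbb T^H$. Call $F$ inner if $F$ is bounded on $\mathbb D_2^H$ and $|F^*|=1$ $\sigma_H$-almost everywhere. **Theorem.** Let $\gamma$ be a finitely supported sequence of nonnegative integers, and let $\tilde\gamma_n=\gamma_n$ for $n\in B$ and $\tilde\gamma_n=0$ for $n\in H$. Then $$\mathrm{orb}_u([\zeta^\gamma])=\left\{F[\zeta^{\tilde\gamma}] : F\in H^2(\mathbb D_2^H)\text{ is inner}\right\},$$ where $F[\zeta^{\tilde\gamma}]=\{FG : G\in[\zeta^{\tilde\gamma}]\}$. -/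

import Mathlib

noncomputable section

namespace WeightedBergman

open MeasureTheory

/-! ### The space -/

/-- The squared norm `‖ζ^α‖² = ∏ₙ αₙ! Γ(βₙ + 2) / Γ(αₙ + βₙ + 2)` of the monomial `ζ^α`.
The factors with `αₙ = 0` equal `1`, so the product runs over the support of `α`. -/
def weight (β : ℕ → Set.Ici (-1 : ℝ)) (α : ℕ →₀ ℕ) : ℝ :=
  α.prod fun n k =>
    (k.factorial : ℝ) * Real.Gamma ((β n : ℝ) + 2) / Real.Gamma ((k : ℝ) + (β n : ℝ) + 2)

theorem weight_pos (β : ℕ → Set.Ici (-1 : ℝ)) (α : ℕ →₀ ℕ) : 0 < weight β α := by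
  refine Finset.prod_pos fun n _ => ?_
  have h : (-1 : ℝ) ≤ β n := (β n).2
  have h1 : 0 < Real.Gamma ((β n : ℝ) + 2) := Real.Gamma_pos_of_pos (by linarith)
  have h2 : 0 < Real.Gamma ((α n : ℝ) + (β n : ℝ) + 2) :=
    Real.Gamma_pos_of_pos (by have : (0 : ℝ) ≤ α n := Nat.cast_nonneg _
                              linarith)
  positivity

theorem factor_antitone {b : ℝ} (hb : -1 ≤ b) (k l : ℕ) :
    ((l + k).factorial : ℝ) * Real.Gamma (b + 2) / Real.Gamma (((l + k : ℕ) : ℝ) + b + 2) ≤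
      (k.factorial : ℝ) * Real.Gamma (b + 2) / Real.Gamma ((k : ℝ) + b + 2) := by
  induction l with
  | zero => simp
  | succ l ih =>
    refine le_trans ?_ ih
    set m := l + k with hm
    have h1 : 0 < Real.Gamma (b + 2) := Real.Gamma_pos_of_pos (by linarith)
    have h0 : (0 : ℝ) ≤ m := Nat.cast_nonneg _
    have h2 : 0 < Real.Gamma ((m : ℝ) + b + 2) := Real.Gamma_pos_of_pos (by linarith)
    have e : l + 1 + k = m + 1 := by omega
    have h3 : Real.Gamma (((m + 1 : ℕ) : ℝ) + b + 2)
        = ((m : ℝ) + b + 2) * Real.Gamma ((m : ℝ) + b + 2) := by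
      rw [← Real.Gamma_add_one (by linarith)]
      congr 1
      push_cast
      ring
    rw [e, h3, Nat.factorial_succ, div_le_div_iff₀ (mul_pos (by linarith) h2) h2]
    push_cast
    have : 0 ≤ (m.factorial : ℝ) * Real.Gamma (b + 2) * Real.Gamma ((m : ℝ) + b + 2) := by
      positivity
    nlinarith

theorem weight_add_le (β : ℕ → Set.Ici (-1 : ℝ)) (δ α : ℕ →₀ ℕ) :
    weight β (δ + α) ≤ weight β α := by
  classical
  have key : ∀ n, (Nat.factorial 0 : ℝ) * Real.Gamma ((β n : ℝ) + 2) /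
      Real.Gamma (((0 : ℕ) : ℝ) + (β n : ℝ) + 2) = 1 := fun n => by
    have h : (-1 : ℝ) ≤ β n := (β n).2
    have h1 : 0 < Real.Gamma ((β n : ℝ) + 2) := Real.Gamma_pos_of_pos (by linarith)
    simp [h1.ne']
  unfold weight
  rw [Finsupp.prod_of_support_subset (δ + α) (s := δ.support ∪ α.support)
      Finsupp.support_add _ (fun n _ => key n),
    Finsupp.prod_of_support_subset α (s := δ.support ∪ α.support)
      Finset.subset_union_right _ (fun n _ => key n)]
  refine Finset.prod_le_prod (fun n _ => ?_) (fun n _ => ?_)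
  · have h : (-1 : ℝ) ≤ β n := (β n).2
    have h1 : 0 < Real.Gamma ((β n : ℝ) + 2) := Real.Gamma_pos_of_pos (by linarith)
    have h2 : 0 < Real.Gamma (((δ + α) n : ℕ) + (β n : ℝ) + 2) :=
      Real.Gamma_pos_of_pos (by
        have : (0 : ℝ) ≤ ((δ + α) n : ℕ) := Nat.cast_nonneg _
        linarith)
    positivity
  · exact factor_antitone (β n).2 (α n) (δ n)

/-- The weighted `ℓ²` coordinates `c_α √ω_α` of a formal power series `∑ c_α ζ^α`. -/
def coords (β : ℕ → Set.Ici (-1 : ℝ)) : MvPowerSeries ℕ ℂ →ₗ[ℂ] ((ℕ →₀ ℕ) → ℂ) where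
  toFun F α := MvPowerSeries.coeff α F * (Real.sqrt (weight β α) : ℂ)
  map_add' F G := by
    funext α
    simp [add_mul]
  map_smul' c F := by
    funext α
    simp [mul_assoc]

theorem norm_coords_sq (β : ℕ → Set.Ici (-1 : ℝ)) (F : MvPowerSeries ℕ ℂ) (α : ℕ →₀ ℕ) :
    ‖coords β F α‖ ^ 2 = ‖MvPowerSeries.coeff α F‖ ^ 2 * weight β α := by
  simp [coords, mul_pow, Real.sq_sqrt (weight_pos β α).le, abs_of_nonneg (Real.sqrt_nonneg _)]

theorem memlp_coords_iff (β : ℕ → Set.Ici (-1 : ℝ)) (F : MvPowerSeries ℕ ℂ) :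
    Memℓp (coords β F) 2 ↔
      Summable fun α : ℕ →₀ ℕ => ‖MvPowerSeries.coeff α F‖ ^ 2 * weight β α := by
  rw [memℓp_gen_iff (by norm_num)]
  simp only [ENNReal.toReal_ofNat, Real.rpow_ofNat, norm_coords_sq]

/-- The weighted Bergman space `A²_β` in infinitely many variables: all series `∑ c_α ζ^α` in
the variables `ζₙ` with `∑ |c_α|² ‖ζ^α‖² < ∞`. -/
def A2 (β : ℕ → Set.Ici (-1 : ℝ)) : Submodule ℂ (MvPowerSeries ℕ ℂ) where
  carrier := {F | Summable fun α : ℕ →₀ ℕ => ‖MvPowerSeries.coeff α F‖ ^ 2 * weight β α}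
  add_mem' {F G} hF hG := by
    have hF' := (memlp_coords_iff β F).2 hF
    have hG' := (memlp_coords_iff β G).2 hG
    exact (memlp_coords_iff β _).1 (by rw [map_add]; exact hF'.add hG')
  zero_mem' := by simp
  smul_mem' c F hF := by
    have hF' := (memlp_coords_iff β F).2 hF
    exact (memlp_coords_iff β _).1 (by rw [map_smul]; exact hF'.const_smul c)

/-- The coordinate map `A²_β → ℓ²`, along which the Hilbert space structure is transported. -/
def toL2 (β : ℕ → Set.Ici (-1 : ℝ)) : A2 β →ₗ[ℂ] lp (fun _ : ℕ →₀ ℕ => ℂ) 2 where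
  toFun F := ⟨coords β F, (memlp_coords_iff β F).2 F.2⟩
  map_add' F G := Subtype.ext ((coords β).map_add F G)
  map_smul' c F := Subtype.ext ((coords β).map_smul c F)

theorem toL2_injective (β : ℕ → Set.Ici (-1 : ℝ)) : Function.Injective (toL2 β) := by
  intro F G h
  refine Subtype.ext (MvPowerSeries.ext fun α => ?_)
  have h1 : coords β F α = coords β G α := congrFun (congrArg Subtype.val h) α
  have h2 : (Real.sqrt (weight β α) : ℂ) ≠ 0 := by
    exact_mod_cast (Real.sqrt_pos.2 (weight_pos β α)).ne'
  exact mul_right_cancel₀ h2 h1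

instance (β : ℕ → Set.Ici (-1 : ℝ)) : NormedAddCommGroup (A2 β) :=
  NormedAddCommGroup.induced (A2 β) (lp (fun _ : ℕ →₀ ℕ => ℂ) 2) (toL2 β) (toL2_injective β)

instance (β : ℕ → Set.Ici (-1 : ℝ)) : InnerProductSpace ℂ (A2 β) :=
  InnerProductSpace.induced (toL2 β)

theorem norm_sq_eq (β : ℕ → Set.Ici (-1 : ℝ)) (F : A2 β) :
    HasSum (fun α : ℕ →₀ ℕ => ‖MvPowerSeries.coeff α (F : MvPowerSeries ℕ ℂ)‖ ^ 2 * weight β α)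
      (‖F‖ ^ 2) := by
  have h := lp.hasSum_norm (p := 2) (by norm_num) (toL2 β F)
  simp only [ENNReal.toReal_ofNat, Real.rpow_ofNat] at h
  have e : (fun α => ‖(toL2 β F : (ℕ →₀ ℕ) → ℂ) α‖ ^ 2) =
      fun α => ‖MvPowerSeries.coeff α (F : MvPowerSeries ℕ ℂ)‖ ^ 2 * weight β α :=
    funext fun α => norm_coords_sq β F α
  rw [e] at h
  exact h

/-! ### The action of polynomials -/

theorem monomial_mul_aux (β : ℕ → Set.Ici (-1 : ℝ)) (δ : ℕ →₀ ℕ) (a : ℂ) (F : A2 β) :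
    ∃ s ≤ (‖a‖ * ‖F‖) ^ 2, HasSum (fun α : ℕ →₀ ℕ => ‖MvPowerSeries.coeff α
      (MvPowerSeries.monomial δ a * (F : MvPowerSeries ℕ ℂ))‖ ^ 2 * weight β α) s := by
  have inj : Function.Injective fun α : ℕ →₀ ℕ => δ + α := add_right_injective δ
  have h0 : ∀ x ∉ Set.range (fun α : ℕ →₀ ℕ => δ + α), ‖MvPowerSeries.coeff x
      (MvPowerSeries.monomial δ a * (F : MvPowerSeries ℕ ℂ))‖ ^ 2 * weight β x = 0 := by
    intro x hx
    rw [MvPowerSeries.coeff_monomial_mul, if_neg]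
    · simp
    · intro hle
      exact hx ⟨x - δ, add_tsub_cancel_of_le hle⟩
  have hF := (norm_sq_eq β F).mul_left (‖a‖ ^ 2)
  have hle : ∀ α : ℕ →₀ ℕ, ‖MvPowerSeries.coeff (δ + α)
      (MvPowerSeries.monomial δ a * (F : MvPowerSeries ℕ ℂ))‖ ^ 2 * weight β (δ + α) ≤
      ‖a‖ ^ 2 * (‖MvPowerSeries.coeff α (F : MvPowerSeries ℕ ℂ)‖ ^ 2 * weight β α) := by
    intro α
    rw [MvPowerSeries.coeff_add_monomial_mul, norm_mul, mul_pow, mul_assoc]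
    have := weight_add_le β δ α
    gcongr
  have hs : Summable fun α : ℕ →₀ ℕ => ‖MvPowerSeries.coeff (δ + α)
      (MvPowerSeries.monomial δ a * (F : MvPowerSeries ℕ ℂ))‖ ^ 2 * weight β (δ + α) :=
    Summable.of_nonneg_of_le (fun α => mul_nonneg (sq_nonneg _) (weight_pos β _).le) hle
      hF.summable
  refine ⟨_, ?_, (inj.hasSum_iff h0).1 hs.hasSum⟩
  rw [mul_pow]
  exact hasSum_le hle hs.hasSum hF

theorem poly_mul_mem (β : ℕ → Set.Ici (-1 : ℝ)) (p : MvPolynomial ℕ ℂ) (F : A2 β) :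
    (p : MvPowerSeries ℕ ℂ) * (F : MvPowerSeries ℕ ℂ) ∈ A2 β := by
  induction p using MvPolynomial.induction_on' with
  | monomial δ a =>
    obtain ⟨s, -, hs⟩ := monomial_mul_aux β δ a F
    rw [MvPolynomial.coe_monomial]
    exact hs.summable
  | add p q hp hq =>
    rw [MvPolynomial.coe_add, add_mul]
    exact add_mem hp hq

/-- `A²_β` as a module over the polynomial ring, which acts by multiplication. -/
instance (β : ℕ → Set.Ici (-1 : ℝ)) : Module (MvPolynomial ℕ ℂ) (A2 β) where
  smul p F := ⟨(p : MvPowerSeries ℕ ℂ) * (F : MvPowerSeries ℕ ℂ), poly_mul_mem β p F⟩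
  one_smul F := Subtype.ext (by
    change ((1 : MvPolynomial ℕ ℂ) : MvPowerSeries ℕ ℂ) * F = F
    rw [MvPolynomial.coe_one, one_mul])
  mul_smul p q F := Subtype.ext (by
    change ((p * q : MvPolynomial ℕ ℂ) : MvPowerSeries ℕ ℂ) * F = p * (q * F)
    rw [MvPolynomial.coe_mul, mul_assoc])
  smul_zero p := Subtype.ext (mul_zero _)
  smul_add p F G := Subtype.ext (mul_add _ _ _)
  add_smul p q F := Subtype.ext (by
    change ((p + q : MvPolynomial ℕ ℂ) : MvPowerSeries ℕ ℂ) * F = p * F + q * F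
    rw [MvPolynomial.coe_add, add_mul])
  zero_smul F := Subtype.ext (by
    change ((0 : MvPolynomial ℕ ℂ) : MvPowerSeries ℕ ℂ) * F = 0
    rw [MvPolynomial.coe_zero, zero_mul])

theorem coe_poly_smul (β : ℕ → Set.Ici (-1 : ℝ)) (p : MvPolynomial ℕ ℂ) (F : A2 β) :
    ((p • F : A2 β) : MvPowerSeries ℕ ℂ) = (p : MvPowerSeries ℕ ℂ) * (F : MvPowerSeries ℕ ℂ) :=
  rfl

/-- Constant polynomials act as scalars. -/
instance (β : ℕ → Set.Ici (-1 : ℝ)) : IsScalarTower ℂ (MvPolynomial ℕ ℂ) (A2 β) where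
  smul_assoc c p F := Subtype.ext (by
    change ((c • p : MvPolynomial ℕ ℂ) : MvPowerSeries ℕ ℂ) * F = c • (p * F)
    rw [MvPolynomial.coe_smul, smul_mul_assoc])

theorem exists_poly_bound (β : ℕ → Set.Ici (-1 : ℝ)) (p : MvPolynomial ℕ ℂ) :
    ∃ C : ℝ, ∀ F : A2 β, ‖p • F‖ ≤ C * ‖F‖ := by
  induction p using MvPolynomial.induction_on' with
  | monomial δ a =>
    refine ⟨‖a‖, fun F => ?_⟩
    obtain ⟨s, hle, hs⟩ := monomial_mul_aux β δ a F
    have h := norm_sq_eq β (MvPolynomial.monomial δ a • F)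
    rw [coe_poly_smul, MvPolynomial.coe_monomial] at h
    rw [← h.unique hs] at hle
    exact le_of_sq_le_sq hle (by positivity)
  | add p q hp hq =>
    obtain ⟨C, hC⟩ := hp
    obtain ⟨D, hD⟩ := hq
    refine ⟨C + D, fun F => ?_⟩
    rw [add_smul, add_mul]
    exact (norm_add_le _ _).trans (add_le_add (hC F) (hD F))

/-- Every polynomial acts as a bounded operator. -/
instance (β : ℕ → Set.Ici (-1 : ℝ)) : ContinuousConstSMul (MvPolynomial ℕ ℂ) (A2 β) where
  continuous_const_smul p := by
    obtain ⟨C, hC⟩ := exists_poly_bound β p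
    exact AddMonoidHomClass.continuous_of_bound (DistribSMul.toAddMonoidHom (A2 β) p) C hC

/-! ### Submodules, generators, unitary orbits -/

/-- A submodule of the Hilbert module `A²_β`: a closed subspace invariant under multiplication
by all polynomials. -/
abbrev HilbertSubmodule (β : ℕ → Set.Ici (-1 : ℝ)) : Type :=
  ClosedSubmodule (MvPolynomial ℕ ℂ) (A2 β)

/-- The submodule `[𝓕]` generated by a subset `𝓕` of `A²_β`. -/
def generated (β : ℕ → Set.Ici (-1 : ℝ)) (𝓕 : Set (A2 β)) : HilbertSubmodule β :=
  (Submodule.span (MvPolynomial ℕ ℂ) 𝓕).closure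

/-- The constant function `1` as an element of `A²_β`. -/
def one (β : ℕ → Set.Ici (-1 : ℝ)) : A2 β :=
  ⟨1, by
    classical
    refine summable_of_ne_finset_zero (s := {0}) fun α hα => ?_
    rw [MvPowerSeries.coeff_one, if_neg (by simpa using hα)]
    simp⟩

/-- The monomial `ζ^γ` as an element of `A²_β`. -/
def zetaPow (β : ℕ → Set.Ici (-1 : ℝ)) (γ : ℕ →₀ ℕ) : A2 β :=
  MvPolynomial.monomial γ (1 : ℂ) • one β

/-- `M` and `N` are unitarily equivalent: there is a unitary map of `M` onto `N` that commutes
with the action of the polynomials (such a map is in particular complex linear). -/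
def UnitarilyEquivalent {β : ℕ → Set.Ici (-1 : ℝ)} (M N : HilbertSubmodule β) : Prop :=
  ∃ U : M.toSubmodule ≃ₗ[MvPolynomial ℕ ℂ] N.toSubmodule, ∀ h, ‖U h‖ = ‖h‖

/-- The unitary orbit of `M`. -/
def unitaryOrbit {β : ℕ → Set.Ici (-1 : ℝ)} (M : HilbertSubmodule β) :
    Set (HilbertSubmodule β) :=
  {N | UnitarilyEquivalent M N}

/-- The set of power series belonging to a submodule of `A²_β`. -/
def seriesSet {β : ℕ → Set.Ici (-1 : ℝ)} (M : HilbertSubmodule β) : Set (MvPowerSeries ℕ ℂ) :=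
  Subtype.val '' (M : Set (A2 β))

/-! ### Inner functions -/

/-- The set `H` of Hardy indices. -/
def hardyIndex (β : ℕ → Set.Ici (-1 : ℝ)) : Set ℕ := {n | (β n : ℝ) = -1}

/-- The Hardy space `H²(𝔻₂^H)`: the functions in `A²_β` whose expansion involves only the
variables `ζₙ` with `n ∈ H`. -/
def hardySpace (β : ℕ → Set.Ici (-1 : ℝ)) : Set (A2 β) :=
  {F | ∀ α : ℕ →₀ ℕ, MvPowerSeries.coeff α (F : MvPowerSeries ℕ ℂ) ≠ 0 →
    (α.support : Set ℕ) ⊆ hardyIndex β}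

/-- The multidisk `𝔻₂^H`: the square-summable sequences in the unit disk supported in `H`. -/
def hardyDisk (β : ℕ → Set.Ici (-1 : ℝ)) : Set (ℕ → ℂ) :=
  {z | (Summable fun n => ‖z n‖ ^ 2) ∧ (∀ n, ‖z n‖ < 1) ∧ ∀ n ∉ hardyIndex β, z n = 0}

/-- The value `F(z) = ∑ c_α z^α`; for `F` in the Hardy space and `z ∈ 𝔻₂^H` the series
converges absolutely. -/
def evalAt (F : MvPowerSeries ℕ ℂ) (z : ℕ → ℂ) : ℂ :=
  ∑' α : ℕ →₀ ℕ, MvPowerSeries.coeff α F * α.prod fun n k => z n ^ k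

instance : MeasurableSpace Circle := borel Circle

instance : BorelSpace Circle := ⟨rfl⟩

/-- The torus `𝕋^H`. -/
abbrev torus (β : ℕ → Set.Ici (-1 : ℝ)) : Type := hardyIndex β → Circle

/-- The normalized Haar measure `σ_H` of `𝕋^H`. -/
def torusHaar (β : ℕ → Set.Ici (-1 : ℝ)) : Measure (torus β) :=
  Measure.haarMeasure ⊤

instance (β : ℕ → Set.Ici (-1 : ℝ)) : IsProbabilityMeasure (torusHaar β) :=
  ⟨Measure.haarMeasure_self (K₀ := (⊤ : TopologicalSpace.PositiveCompacts (torus β)))⟩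

/-- A point of `𝕋^H` as a sequence, with the entry `1` outside `H`. -/
def torusPoint {β : ℕ → Set.Ici (-1 : ℝ)} (t : torus β) (n : ℕ) : Circle :=
  haveI := Classical.dec (n ∈ hardyIndex β)
  if h : n ∈ hardyIndex β then t ⟨n, h⟩ else 1

theorem continuous_torusPoint {β : ℕ → Set.Ici (-1 : ℝ)} (n : ℕ) :
    Continuous fun t : torus β => torusPoint t n := by
  unfold torusPoint
  split_ifs with h
  · exact continuous_apply _
  · exact continuous_const

/-- The monomial `ζ^α` as a continuous function on `𝕋^H`. -/
def torusMonomial (β : ℕ → Set.Ici (-1 : ℝ)) (α : ℕ →₀ ℕ) : C(torus β, ℂ) where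
  toFun t := α.prod fun n k => (torusPoint t n : ℂ) ^ k
  continuous_toFun := continuous_finsetProd _ fun n _ =>
    (continuous_subtype_val.comp (continuous_torusPoint n)).pow _

/-- `g ∈ L²(𝕋^H, σ_H)` is the boundary function of `F = ∑ c_α ζ^α` in the Hardy space: the
image of `F` under the isometry of `H²(𝔻₂^H)` into `L²(𝕋^H, σ_H)` that sends each monomial to
its restriction to the torus. -/
def IsBoundaryFunction {β : ℕ → Set.Ici (-1 : ℝ)} (F : A2 β)
    (g : Lp ℂ 2 (torusHaar β)) : Prop :=
  HasSum (fun α : ℕ →₀ ℕ => MvPowerSeries.coeff α (F : MvPowerSeries ℕ ℂ) •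
    ContinuousMap.toLp (E := ℂ) 2 (torusHaar β) ℂ (torusMonomial β α)) g

/-- `F ∈ H²(𝔻₂^H)` is inner: it is bounded on `𝔻₂^H`, and its boundary function is unimodular
almost everywhere. -/
structure IsInner {β : ℕ → Set.Ici (-1 : ℝ)} (F : A2 β) : Prop where
  mem_hardySpace : F ∈ hardySpace β
  bounded : ∃ C : ℝ, ∀ z ∈ hardyDisk β, ‖evalAt F z‖ ≤ C
  boundary : ∃ g : Lp ℂ 2 (torusHaar β),
    IsBoundaryFunction F g ∧ ∀ᵐ t ∂(torusHaar β), ‖g t‖ = 1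

/-- The multi-index `γ̃`, which agrees with `γ` on `B` and vanishes on `H`. -/
def bergmanPart (β : ℕ → Set.Ici (-1 : ℝ)) (γ : ℕ →₀ ℕ) : ℕ →₀ ℕ :=
  haveI : DecidablePred fun n => (β n : ℝ) ≠ -1 := Classical.decPred _
  γ.filter fun n => (β n : ℝ) ≠ -1

end WeightedBergman

end

/-
A unitary module map carries `ζ^γ` to a generator `K` with `‖p K‖ = ‖p ζ^γ‖` for every polynomial
`p`. Comparing these norms for `p = 1, ζₙ, ζₙ²` with `n ∈ B`, a combination of the three weights
weighs the coefficient of `ζ^κ` by a positive multiple of `(κₙ - γₙ)²`; hence only exponents with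
`κₙ = γₙ` occur, and `K = ζ^γ̃ F` with `F` in the Hardy space. The weight is multiplicative across
the splitting of the variables into `H` and `B`, so `‖p F‖ = ‖p‖` for all `p`, i.e. `F` is an
isometric multiplier.

Isometric multipliers are the inner functions: the moments `⟨ζ^α F, ζ^δ F⟩` are the Fourier
coefficients of `|F*|² σ_H`, and the isometry condition says that they agree with those of `σ_H`.
Pairing `F k_z` with the Szegő kernel `k_z` bounds `|F(z)|` by `1`.
-/

noncomputable section

namespace WeightedBergman

open MeasureTheory ComplexConjugate

open MvPowerSeries (coeff)

section HilbertModules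

variable {R E F : Type*} [Ring R] [NormedAddCommGroup E] [Module R E] [CompleteSpace E]
  [NormedAddCommGroup F] [Module R F]

theorem image_closure_span (T : E →ₗᵢ[R] F) (s : Set E) :
    T '' closure (Submodule.span R s) = closure (Submodule.span R (T '' s)) := by
  rw [← T.isometry.isClosedEmbedding.closure_image_eq]
  exact congrArg (fun K : Submodule R F => closure (K : Set F)) (Submodule.map_span T.toLinearMap s)

theorem exists_eq_closure_span_singleton_of_equiv [ContinuousConstSMul R E]
    [ContinuousConstSMul R F] {x : E} {N : ClosedSubmodule R F}
    (U : (Submodule.span R {x}).closure.toSubmodule ≃ₗᵢ[R] N.toSubmodule) :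
    ∃ y : F, N = (Submodule.span R {y}).closure ∧ ∀ r : R, ‖r • y‖ = ‖r • x‖ := by
  set M := (Submodule.span R {x}).closure
  have : CompleteSpace M.toSubmodule := M.isClosed.completeSpace_coe
  let x' : M.toSubmodule := ⟨x, subset_closure (Submodule.mem_span_singleton_self x)⟩
  have hdense : closure (Submodule.span R {x'} : Set M.toSubmodule) = Set.univ := by
    apply M.toSubmodule.subtype_injective.image_injective
    refine (image_closure_span M.toSubmodule.subtypeₗᵢ {x'}).trans ?_
    rw [Set.image_singleton, Set.image_univ]
    exact Subtype.range_coe.symm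
  let T : M.toSubmodule →ₗᵢ[R] F := N.toSubmodule.subtypeₗᵢ.comp U.toLinearIsometry
  refine ⟨T x', SetLike.coe_injective ?_, fun r => ?_⟩
  · calc (N : Set F) = Set.range T :=
        (U.surjective.range_comp _).trans Subtype.range_coe |>.symm
      _ = T '' closure (Submodule.span R {x'}) := by rw [hdense, Set.image_univ]
      _ = closure (Submodule.span R {T x'}) := by rw [image_closure_span, Set.image_singleton]
  · rw [← map_smul, T.norm_map]
    rfl

end HilbertModules

section Polarization

variable {𝕜 R E : Type*} [RCLike 𝕜] [Ring R] [Algebra 𝕜 R]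
  [NormedAddCommGroup E] [InnerProductSpace 𝕜 E] [Module R E] [IsScalarTower 𝕜 R E]

theorem inner_smul_smul_eq_of_norm_smul_eq {x y : E} (h : ∀ r : R, ‖r • y‖ = ‖r • x‖)
    (r s : R) : inner 𝕜 (r • y) (s • y) = inner 𝕜 (r • x) (s • x) := by
  have hI (z : E) : (RCLike.I : 𝕜) • s • z = ((RCLike.I : 𝕜) • s) • z := (smul_assoc _ _ _).symm
  simp only [inner_eq_sum_norm_sq_div_four (𝕜 := 𝕜), hI, ← add_smul, ← sub_smul, h]

end Polarization

theorem norm_smul_eq_of_inner_monomial_smul_eq {σ 𝕜 E : Type*} [RCLike 𝕜]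
    [NormedAddCommGroup E] [InnerProductSpace 𝕜 E] [Module (MvPolynomial σ 𝕜) E]
    [IsScalarTower 𝕜 (MvPolynomial σ 𝕜) E] {x y : E}
    (h : ∀ α δ : σ →₀ ℕ,
      inner 𝕜 (MvPolynomial.monomial α (1 : 𝕜) • y) (MvPolynomial.monomial δ (1 : 𝕜) • y) =
        inner 𝕜 (MvPolynomial.monomial α (1 : 𝕜) • x) (MvPolynomial.monomial δ (1 : 𝕜) • x))
    (p : MvPolynomial σ 𝕜) : ‖p • y‖ = ‖p • x‖ := by
  have smul_monomial (α : σ →₀ ℕ) (c : 𝕜) (z : E) : MvPolynomial.monomial α c • z =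
      c • MvPolynomial.monomial α (1 : 𝕜) • z := by
    rw [← smul_assoc, MvPolynomial.smul_monomial, smul_eq_mul, mul_one]
  have inner_eq (p q : MvPolynomial σ 𝕜) : inner 𝕜 (p • y) (q • y) = inner 𝕜 (p • x) (q • x) := by
    induction p using MvPolynomial.induction_on' with
    | add p p' hp hp' => simp only [add_smul, inner_add_left, hp, hp']
    | monomial α a =>
      induction q using MvPolynomial.induction_on' with
      | add q q' hq hq' => simp only [add_smul, inner_add_right, hq, hq']
      | monomial δ d =>
        simp only [smul_monomial _ a, smul_monomial _ d, inner_smul_left, inner_smul_right, h]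
  simp only [norm_eq_sqrt_re_inner (𝕜 := 𝕜), inner_eq]

section Weights

/-- The squared norm `k! Γ(b + 2) / Γ(k + b + 2)` of `z ^ k` in the weighted Bergman space of the
unit disk with parameter `b`, one factor of `weight`. -/
def weightFactor (b : ℝ) (k : ℕ) : ℝ :=
  (k.factorial : ℝ) * Real.Gamma (b + 2) / Real.Gamma ((k : ℝ) + b + 2)

theorem weightFactor_pos {b : ℝ} (hb : -1 ≤ b) (k : ℕ) : 0 < weightFactor b k := by
  have : (0 : ℝ) ≤ k := k.cast_nonneg
  exact div_pos (mul_pos (by positivity) (Real.Gamma_pos_of_pos (by linarith)))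
    (Real.Gamma_pos_of_pos (by linarith))

theorem weightFactor_zero {b : ℝ} (hb : -1 ≤ b) : weightFactor b 0 = 1 := by
  have : Real.Gamma (b + 2) ≠ 0 := (Real.Gamma_pos_of_pos (by linarith)).ne'
  simp [weightFactor, this]

theorem weightFactor_neg_one (k : ℕ) : weightFactor (-1) k = 1 := by
  have h : (k : ℝ) + -1 + 2 = k + 1 := by ring
  have h' : (-1 : ℝ) + 2 = 1 := by norm_num
  rw [weightFactor, h, h', Real.Gamma_nat_eq_factorial, Real.Gamma_one, mul_one,
    div_self (Nat.cast_ne_zero.2 k.factorial_ne_zero)]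

theorem weightFactor_succ {b : ℝ} (hb : -1 ≤ b) (k : ℕ) :
    weightFactor b (k + 1) = weightFactor b k * ((k + 1) / (k + b + 2)) := by
  have : (0 : ℝ) ≤ k := k.cast_nonneg
  have hpos : 0 < (k : ℝ) + b + 2 := by linarith
  have h : ((k + 1 : ℕ) : ℝ) + b + 2 = (k + b + 2) + 1 := by push_cast; ring
  rw [weightFactor, weightFactor, h, Real.Gamma_add_one hpos.ne', Nat.factorial_succ]
  have := Real.Gamma_pos_of_pos hpos
  push_cast
  field_simp

variable (β : ℕ → Set.Ici (-1 : ℝ))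

theorem weight_eq_prod (α : ℕ →₀ ℕ) :
    weight β α = α.prod fun n k => weightFactor (β n) k :=
  rfl

theorem weight_zero : weight β 0 = 1 :=
  Finsupp.prod_zero_index

theorem weight_single_add (n : ℕ) (k : ℕ) (κ : ℕ →₀ ℕ) :
    weight β (Finsupp.single n k + κ) =
      weight β κ * (weightFactor (β n) (k + κ n) / weightFactor (β n) (κ n)) := by
  have split (κ : ℕ →₀ ℕ) : weight β κ = weightFactor (β n) (κ n) * weight β (κ.erase n) :=
    (Finsupp.mul_prod_erase' κ n _ fun n => weightFactor_zero (β n).2).symm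
  rw [split, split κ, Finsupp.erase_add, Finsupp.erase_single, zero_add, Finsupp.add_apply,
    Finsupp.single_eq_same]
  have := (weightFactor_pos (β n).2 (κ n)).ne'
  field_simp

end Weights

section ExponentSplitting

variable (β : ℕ → Set.Ici (-1 : ℝ))

open Classical in
theorem bergmanPart_apply (γ : ℕ →₀ ℕ) (n : ℕ) :
    bergmanPart β γ n = if n ∈ hardyIndex β then 0 else γ n := by
  rw [bergmanPart, Finsupp.filter_apply]
  by_cases hn : n ∈ hardyIndex β
  · exact (if_neg (not_not.2 hn)).trans (if_pos hn).symm
  · exact (if_pos hn).trans (if_neg hn).symm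

theorem bergmanPart_zero : bergmanPart β 0 = 0 := by
  ext n
  simp [bergmanPart_apply]

theorem bergmanPart_add (α γ : ℕ →₀ ℕ) :
    bergmanPart β (α + γ) = bergmanPart β α + bergmanPart β γ := by
  ext n
  by_cases hn : n ∈ hardyIndex β <;> simp [bergmanPart_apply, hn]

theorem bergmanPart_le (γ : ℕ →₀ ℕ) : bergmanPart β γ ≤ γ := by
  intro n
  by_cases hn : n ∈ hardyIndex β <;> simp [bergmanPart_apply, hn]

theorem bergmanPart_bergmanPart (γ : ℕ →₀ ℕ) :
    bergmanPart β (bergmanPart β γ) = bergmanPart β γ := by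
  ext n
  by_cases hn : n ∈ hardyIndex β <;> simp [bergmanPart_apply, hn]

theorem bergmanPart_eq_zero_iff {γ : ℕ →₀ ℕ} :
    bergmanPart β γ = 0 ↔ (γ.support : Set ℕ) ⊆ hardyIndex β := by
  simp only [Finsupp.ext_iff, bergmanPart_apply, Finsupp.coe_zero, Pi.zero_apply,
    ite_eq_left_iff, not_imp_comm, Set.subset_def, Finset.mem_coe, Finsupp.mem_support_iff, ne_eq]

/-- The multi-index that agrees with `γ` on `H` and vanishes on `B`. -/
def hardyPart (γ : ℕ →₀ ℕ) : ℕ →₀ ℕ := γ - bergmanPart β γ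

theorem hardyPart_add_bergmanPart (γ : ℕ →₀ ℕ) : hardyPart β γ + bergmanPart β γ = γ :=
  tsub_add_cancel_of_le (bergmanPart_le β γ)

theorem bergmanPart_hardyPart (γ : ℕ →₀ ℕ) : bergmanPart β (hardyPart β γ) = 0 := by
  have h := bergmanPart_add β (hardyPart β γ) (bergmanPart β γ)
  rw [hardyPart_add_bergmanPart, bergmanPart_bergmanPart] at h
  exact left_eq_add.1 (h.trans (add_comm _ _))

theorem weight_bergmanPart (γ : ℕ →₀ ℕ) : weight β (bergmanPart β γ) = weight β γ := by
  rw [weight_eq_prod, weight_eq_prod, Finsupp.prod_of_support_subset _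
    (Finsupp.support_mono (bergmanPart_le β γ)) _ fun n _ => weightFactor_zero (β n).2]
  refine Finset.prod_congr rfl fun n _ => ?_
  rw [bergmanPart_apply]
  split_ifs with hn
  · have hn : (β n : ℝ) = -1 := hn
    simp only [hn, weightFactor_neg_one]
  · rfl

theorem weight_add_of_bergmanPart_eq_zero {α : ℕ →₀ ℕ} (hα : bergmanPart β α = 0)
    (κ : ℕ →₀ ℕ) : weight β (α + κ) = weight β κ := by
  rw [← weight_bergmanPart, bergmanPart_add, hα, zero_add, weight_bergmanPart]

theorem weight_of_bergmanPart_eq_zero {α : ℕ →₀ ℕ} (hα : bergmanPart β α = 0) :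
    weight β α = 1 := by
  rw [← weight_bergmanPart, hα, weight_zero]

end ExponentSplitting

section HilbertStructure

variable (β : ℕ → Set.Ici (-1 : ℝ))

theorem mem_hardySpace_iff {β : ℕ → Set.Ici (-1 : ℝ)} {F : A2 β} :
    F ∈ hardySpace β ↔ ∀ α, coeff α F.1 ≠ 0 → bergmanPart β α = 0 :=
  forall₂_congr fun _ _ => (bergmanPart_eq_zero_iff β).symm

theorem toL2_surjective : Function.Surjective (toL2 β) := by
  intro f
  have hsqrt (α : ℕ →₀ ℕ) : (Real.sqrt (weight β α) : ℂ) ≠ 0 := by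
    exact_mod_cast (Real.sqrt_pos.2 (weight_pos β α)).ne'
  have hf : coords β (fun α => f.1 α / (Real.sqrt (weight β α) : ℂ)) = f.1 :=
    funext fun α => div_mul_cancel₀ _ (hsqrt α)
  exact ⟨⟨_, (memlp_coords_iff β _).1 (by rw [hf]; exact lp.memℓp f)⟩, Subtype.ext hf⟩

instance : CompleteSpace (A2 β) :=
  (LinearIsometryEquiv.ofSurjective ⟨toL2 β, fun _ => rfl⟩
    (toL2_surjective β)).toIsometryEquiv.completeSpace

variable {β}

theorem hasSum_inner (F G : A2 β) :
    HasSum (fun α : ℕ →₀ ℕ => conj (coeff α F.1) * coeff α G.1 * (weight β α : ℂ))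
      (inner ℂ F G) := by
  refine (lp.hasSum_inner (𝕜 := ℂ) (toL2 β F) (toL2 β G)).congr_fun fun α => ?_
  have hsqrt : (Real.sqrt (weight β α) : ℂ) * Real.sqrt (weight β α) = weight β α := by
    exact_mod_cast Real.mul_self_sqrt (weight_pos β α).le
  change _ = inner ℂ (coeff α F.1 * (Real.sqrt (weight β α) : ℂ)) (coeff α G.1 * _)
  rw [RCLike.inner_apply, map_mul, Complex.conj_ofReal, ← hsqrt]
  ring

end HilbertStructure

section Monomials

variable {β : ℕ → Set.Ici (-1 : ℝ)}

/-- The monomial `ζ^α` as a polynomial, that is, as an element of the acting ring. -/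
abbrev mono (α : ℕ →₀ ℕ) : MvPolynomial ℕ ℂ := MvPolynomial.monomial α 1

theorem mono_add_smul (α δ : ℕ →₀ ℕ) (F : A2 β) : mono (α + δ) • F = mono α • mono δ • F := by
  rw [← mul_smul, MvPolynomial.monomial_mul, one_mul]

theorem coe_mono_smul (α : ℕ →₀ ℕ) (F : A2 β) :
    (mono α • F).1 = MvPowerSeries.monomial α 1 * F.1 := by
  rw [coe_poly_smul, MvPolynomial.coe_monomial]

theorem coeff_add_mono_smul (α κ : ℕ →₀ ℕ) (F : A2 β) :
    coeff (α + κ) (mono α • F).1 = coeff κ F.1 := by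
  rw [coe_mono_smul, MvPowerSeries.coeff_add_monomial_mul, one_mul]

theorem exists_add_of_coeff_mono_smul_ne_zero {α κ : ℕ →₀ ℕ} {F : A2 β}
    (h : coeff κ (mono α • F).1 ≠ 0) : ∃ τ, κ = α + τ ∧ coeff τ F.1 ≠ 0 := by
  rw [coe_mono_smul, MvPowerSeries.coeff_monomial_mul, ite_ne_right_iff] at h
  obtain ⟨τ, rfl⟩ := exists_add_of_le h.1
  rw [add_tsub_cancel_left, one_mul] at h
  exact ⟨τ, rfl, h.2⟩

theorem hasSum_inner_mono_smul (α : ℕ →₀ ℕ) (F G : A2 β) :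
    HasSum (fun κ : ℕ →₀ ℕ => conj (coeff κ F.1) * coeff κ G.1 * (weight β (α + κ) : ℂ))
      (inner ℂ (mono α • F) (mono α • G)) := by
  have h := hasSum_inner (mono α • F) (mono α • G)
  rw [← (add_right_injective α).hasSum_iff fun κ hκ => ?_] at h
  · simpa only [Function.comp_def, coeff_add_mono_smul] using h
  · contrapose! hκ
    obtain ⟨τ, rfl, -⟩ := exists_add_of_coeff_mono_smul_ne_zero
      (right_ne_zero_of_mul (left_ne_zero_of_mul hκ))
    exact ⟨τ, rfl⟩

theorem hasSum_norm_sq_mono_smul (α : ℕ →₀ ℕ) (F : A2 β) :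
    HasSum (fun κ : ℕ →₀ ℕ => ‖coeff κ F.1‖ ^ 2 * weight β (α + κ)) (‖mono α • F‖ ^ 2) := by
  have h := Complex.hasSum_re (hasSum_inner_mono_smul α F F)
  rw [inner_self_eq_norm_sq_to_K] at h
  convert h using 2 with κ
  · rw [Complex.conj_mul']
    norm_cast
  · norm_cast

theorem coeff_one (α : ℕ →₀ ℕ) : coeff α (one β).1 = if α = 0 then 1 else 0 :=
  MvPowerSeries.coeff_one α

theorem zetaPow_zero : zetaPow β 0 = one β :=
  one_smul _ _

theorem mono_smul_zetaPow (α γ : ℕ →₀ ℕ) : mono α • zetaPow β γ = zetaPow β (α + γ) :=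
  (mono_add_smul α γ (one β)).symm

theorem coeff_zetaPow (α γ : ℕ →₀ ℕ) :
    coeff α (zetaPow β γ).1 = if α = γ then 1 else 0 := by
  rw [zetaPow, coe_mono_smul]
  change coeff α (_ * 1) = _
  rw [mul_one, MvPowerSeries.coeff_monomial]

theorem inner_zetaPow_left (α : ℕ →₀ ℕ) (F : A2 β) :
    inner ℂ (zetaPow β α) F = weight β α * coeff α F.1 := by
  refine (hasSum_inner _ _).unique ?_
  convert hasSum_ite_eq α (weight β α * coeff α F.1) using 2 with κ
  rw [coeff_zetaPow]
  split_ifs with hκ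
  · rw [hκ, map_one, one_mul, mul_comm]
  · simp

theorem norm_sq_zetaPow (γ : ℕ →₀ ℕ) : ‖zetaPow β γ‖ ^ 2 = weight β γ := by
  rw [← inner_self_eq_norm_sq (𝕜 := ℂ), inner_zetaPow_left, coeff_zetaPow, if_pos rfl, mul_one]
  exact Complex.ofReal_re _

theorem continuous_coeff (α : ℕ →₀ ℕ) : Continuous fun F : A2 β => coeff α F.1 := by
  have hα : (weight β α : ℂ) ≠ 0 := by exact_mod_cast (weight_pos β α).ne'
  have h (F : A2 β) : coeff α F.1 = (weight β α : ℂ)⁻¹ * inner ℂ (zetaPow β α) F := by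
    rw [inner_zetaPow_left, inv_mul_cancel_left₀ hα]
  simp only [h]
  fun_prop

theorem dense_range_smul_one : DenseRange fun p : MvPolynomial ℕ ℂ => p • one β := by
  have hspan : (Submodule.span ℂ (Set.range (zetaPow β))).topologicalClosure = ⊤ := by
    rw [Submodule.topologicalClosure_eq_top_iff, Submodule.eq_bot_iff]
    intro F hF
    refine Subtype.ext (MvPowerSeries.ext fun α => ?_)
    have h := hF _ (Submodule.subset_span ⟨α, rfl⟩)
    rw [inner_zetaPow_left, mul_eq_zero] at h
    exact h.resolve_left (by exact_mod_cast (weight_pos β α).ne')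
  have hsub : Submodule.span ℂ (Set.range (zetaPow β)) ≤
      LinearMap.range
        ((LinearMap.toSpanSingleton (MvPolynomial ℕ ℂ) _ (one β)).restrictScalars ℂ) :=
    Submodule.span_le.2 (Set.range_subset_iff.2 fun α => ⟨mono α, rfl⟩)
  exact (Submodule.dense_iff_topologicalClosure_eq_top.2 hspan).mono hsub

end Monomials

section IsometricMultipliers

variable {β : ℕ → Set.Ici (-1 : ℝ)}

/-- `F` is an isometric multiplier of `A²_β`. The definition only tests polynomials; by density,
`IsIsometricMultiplier.mulLeft` extends multiplication by `F` to an isometry of all of `A²_β`. -/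
def IsIsometricMultiplier (F : A2 β) : Prop :=
  ∀ p : MvPolynomial ℕ ℂ, ‖p • F‖ = ‖p • one β‖

theorem IsIsometricMultiplier.exists_eq_mul {F : A2 β} (hF : IsIsometricMultiplier F)
    (G : A2 β) : ∃ K : A2 β, K.1 = F.1 * G.1 ∧ ‖K‖ = ‖G‖ := by
  obtain ⟨u, hu, hlim⟩ := mem_closure_iff_seq_limit.1 (dense_range_smul_one G)
  choose p hp using hu
  have hdist (m n : ℕ) : dist (p m • F) (p n • F) = dist (u m) (u n) := by
    rw [← hp, ← hp, dist_eq_norm, dist_eq_norm, ← sub_smul, ← sub_smul, hF]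
  have hcauchy : CauchySeq fun n => p n • F := by
    simpa only [Metric.cauchySeq_iff, hdist] using Metric.cauchySeq_iff.1 hlim.cauchySeq
  obtain ⟨K, hK⟩ := cauchySeq_tendsto_of_complete hcauchy
  refine ⟨K, MvPowerSeries.ext fun α =>
    tendsto_nhds_unique (((continuous_coeff α).tendsto K).comp hK) ?_,
    tendsto_nhds_unique hK.norm (hlim.norm.congr fun n => by rw [← hp, hF])⟩
  have hmul (n : ℕ) : (p n • F).1 = F.1 * (u n).1 := by
    rw [← hp, coe_poly_smul, coe_poly_smul, mul_left_comm]
    exact congrArg _ (mul_one _).symm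
  simp only [Function.comp_def, hmul, MvPowerSeries.coeff_mul]
  exact tendsto_finsetSum _ fun κ _ =>
    (((continuous_coeff κ.2).tendsto G).comp hlim).const_mul _

theorem IsIsometricMultiplier.mul_mem {F : A2 β} (hF : IsIsometricMultiplier F) (G : A2 β) :
    F.1 * G.1 ∈ A2 β := by
  obtain ⟨K, hK, -⟩ := hF.exists_eq_mul G
  exact hK ▸ K.2

/-- Multiplication by an isometric multiplier, as an isometry of the Hilbert module `A²_β`. -/
def IsIsometricMultiplier.mulLeft {F : A2 β} (hF : IsIsometricMultiplier F) :
    A2 β →ₗᵢ[MvPolynomial ℕ ℂ] A2 β where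
  toFun G := ⟨F.1 * G.1, hF.mul_mem G⟩
  map_add' _ _ := Subtype.ext (mul_add _ _ _)
  map_smul' _ _ := Subtype.ext (mul_left_comm _ _ _)
  norm_map' G := by
    obtain ⟨K, hK, hnorm⟩ := hF.exists_eq_mul G
    exact (congrArg norm (Subtype.ext hK.symm)).trans hnorm

theorem IsIsometricMultiplier.coe_mulLeft {F : A2 β} (hF : IsIsometricMultiplier F) (G : A2 β) :
    (hF.mulLeft G).1 = F.1 * G.1 :=
  rfl

theorem IsIsometricMultiplier.mulLeft_zetaPow {F : A2 β} (hF : IsIsometricMultiplier F)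
    (α : ℕ →₀ ℕ) : hF.mulLeft (zetaPow β α) = mono α • F := by
  rw [zetaPow, map_smul]
  exact congrArg _ (Subtype.ext (mul_one F.1))

theorem seriesSet_generated_mulLeft {F : A2 β} (hF : IsIsometricMultiplier F) (x : A2 β) :
    seriesSet (generated β {hF.mulLeft x}) = (F.1 * ·) '' seriesSet (generated β {x}) := by
  have himage : (generated β {hF.mulLeft x} : Set (A2 β)) = hF.mulLeft '' generated β {x} := by
    rw [← Set.image_singleton]
    exact (image_closure_span hF.mulLeft {x}).symm
  rw [seriesSet, himage, seriesSet, Set.image_image, Set.image_image]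
  rfl

theorem UnitarilyEquivalent.symm {M N : HilbertSubmodule β} (h : UnitarilyEquivalent M N) :
    UnitarilyEquivalent N M := by
  obtain ⟨U, hU⟩ := h
  exact ⟨U.symm, fun x => by rw [← hU, U.apply_symm_apply]⟩

theorem UnitarilyEquivalent.trans {L M N : HilbertSubmodule β} (h : UnitarilyEquivalent L M)
    (h' : UnitarilyEquivalent M N) : UnitarilyEquivalent L N := by
  obtain ⟨U, hU⟩ := h
  obtain ⟨V, hV⟩ := h'
  exact ⟨U.trans V, fun x => (hV _).trans (hU x)⟩

theorem unitarilyEquivalent_generated_image (T : A2 β →ₗᵢ[MvPolynomial ℕ ℂ] A2 β)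
    (𝓕 : Set (A2 β)) : UnitarilyEquivalent (generated β 𝓕) (generated β (T '' 𝓕)) :=
  ⟨(Submodule.equivMapOfInjective T.toLinearMap T.injective _).trans
    (LinearEquiv.ofEq _ _ (SetLike.coe_injective (image_closure_span T 𝓕))),
    fun x => T.norm_map x⟩

theorem norm_mono_smul {α : ℕ →₀ ℕ} (hα : bergmanPart β α = 0) (F : A2 β) :
    ‖mono α • F‖ = ‖F‖ := by
  have h := hasSum_norm_sq_mono_smul α F
  simp only [weight_add_of_bergmanPart_eq_zero β hα] at h
  exact (pow_left_inj₀ (norm_nonneg _) (norm_nonneg _) two_ne_zero).1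
    (h.unique (norm_sq_eq β F))

theorem isIsometricMultiplier_zetaPow {α : ℕ →₀ ℕ} (hα : bergmanPart β α = 0) :
    IsIsometricMultiplier (zetaPow β α) := fun p => by
  rw [zetaPow, smul_comm, norm_mono_smul hα]

theorem unitarilyEquivalent_generated_bergmanPart (γ : ℕ →₀ ℕ) :
    UnitarilyEquivalent (generated β {zetaPow β γ})
      (generated β {zetaPow β (bergmanPart β γ)}) := by
  have hT := isIsometricMultiplier_zetaPow (bergmanPart_hardyPart β γ)
  have h := unitarilyEquivalent_generated_image hT.mulLeft {zetaPow β (bergmanPart β γ)}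
  rw [Set.image_singleton, hT.mulLeft_zetaPow, mono_smul_zetaPow, add_comm,
    hardyPart_add_bergmanPart] at h
  exact h.symm

end IsometricMultipliers

section HardySpace

variable {β : ℕ → Set.Ici (-1 : ℝ)}

theorem one_mem_hardySpace : one β ∈ hardySpace β :=
  mem_hardySpace_iff.2 fun α hα => by
    rw [coeff_one, ite_ne_right_iff] at hα
    rw [hα.1, bergmanPart_zero]

theorem mono_smul_mem_hardySpace {α : ℕ →₀ ℕ} (hα : bergmanPart β α = 0) {F : A2 β}
    (hF : F ∈ hardySpace β) : mono α • F ∈ hardySpace β :=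
  mem_hardySpace_iff.2 fun κ hκ => by
    obtain ⟨τ, rfl, hτ⟩ := exists_add_of_coeff_mono_smul_ne_zero hκ
    rw [bergmanPart_add, hα, mem_hardySpace_iff.1 hF τ hτ, add_zero]

theorem inner_mono_smul_mono_smul_self {F : A2 β} (hF : F ∈ hardySpace β) (G : A2 β)
    (δ : ℕ →₀ ℕ) : inner ℂ (mono δ • F) (mono δ • G) = weight β δ * inner ℂ F G := by
  refine (hasSum_inner_mono_smul δ F G).unique
    (((hasSum_inner F G).mul_left _).congr_fun fun κ => ?_)
  by_cases hκ : coeff κ F.1 = 0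
  · simp [hκ]
  · have hκ := mem_hardySpace_iff.1 hF κ hκ
    rw [add_comm, weight_add_of_bergmanPart_eq_zero β hκ, weight_of_bergmanPart_eq_zero β hκ]
    push_cast
    ring

theorem inner_mono_smul_mono_smul_eq_zero {F G : A2 β} (hF : F ∈ hardySpace β)
    (hG : G ∈ hardySpace β) {α δ : ℕ →₀ ℕ} (h : bergmanPart β α ≠ bergmanPart β δ) :
    inner ℂ (mono α • F) (mono δ • G) = 0 := by
  refine (hasSum_inner _ _).unique (hasSum_zero.congr_fun fun κ => ?_)
  by_contra hne
  obtain ⟨τ, rfl, hτ⟩ := exists_add_of_coeff_mono_smul_ne_zero (α := α) (F := F) (κ := κ)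
    fun h0 => hne (by simp [h0])
  obtain ⟨τ', hκ, hτ'⟩ := exists_add_of_coeff_mono_smul_ne_zero (α := δ) (F := G) (κ := α + τ)
    fun h0 => hne (by simp [h0])
  have hκ := congrArg (bergmanPart β) hκ
  rw [bergmanPart_add, bergmanPart_add, mem_hardySpace_iff.1 hF τ hτ,
    mem_hardySpace_iff.1 hG τ' hτ', add_zero, add_zero] at hκ
  exact h hκ

theorem inner_mono_smul_mono_smul {F G : A2 β} (hF : F ∈ hardySpace β) (hG : G ∈ hardySpace β)
    (α δ : ℕ →₀ ℕ) : inner ℂ (mono α • F) (mono δ • G) =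
      if bergmanPart β α = bergmanPart β δ then
        weight β α * inner ℂ (mono (hardyPart β α) • F) (mono (hardyPart β δ) • G)
      else 0 := by
  split_ifs with h
  · rw [← weight_bergmanPart, ← inner_mono_smul_mono_smul_self
      (mono_smul_mem_hardySpace (bergmanPart_hardyPart β α) hF), ← mono_add_smul,
      ← mono_add_smul, add_comm, hardyPart_add_bergmanPart, h, add_comm,
      hardyPart_add_bergmanPart]
  · exact inner_mono_smul_mono_smul_eq_zero hF hG h

theorem isIsometricMultiplier_of_inner_mono_smul {F : A2 β} (hF : F ∈ hardySpace β)
    (h : ∀ α δ, bergmanPart β α = 0 → bergmanPart β δ = 0 →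
      inner ℂ (mono α • F) (mono δ • F) = inner ℂ (mono α • one β) (mono δ • one β)) :
    IsIsometricMultiplier F :=
  norm_smul_eq_of_inner_monomial_smul_eq fun α δ => by
    rw [inner_mono_smul_mono_smul hF hF, inner_mono_smul_mono_smul one_mem_hardySpace
      one_mem_hardySpace, h _ _ (bergmanPart_hardyPart β α) (bergmanPart_hardyPart β δ)]

end HardySpace

section Rigidity

variable {β : ℕ → Set.Ici (-1 : ℝ)}

/- The quadratic `(j - g)²` is a combination of `(j + b + 2)(j + b + 3)`, `(j + 1)(j + b + 3)` and
`(j + 1)(j + 2)`; the coefficients are read off at `j = -1`, `j = -b - 3` and `j = ∞`. -/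
theorem exists_weightFactor_combination_eq {b : ℝ} (hb : -1 < b) (g : ℕ) :
    ∃ x y z : ℝ, ∀ j : ℕ,
      x * weightFactor b j + y * weightFactor b (j + 1) + z * weightFactor b (j + 2) =
        weightFactor b j * (((j : ℝ) - g) ^ 2 / ((j + b + 2) * (j + b + 3))) := by
  have h1 : b + 1 ≠ 0 := by linarith
  have h2 : b + 2 ≠ 0 := by linarith
  let x : ℝ := (1 + g) ^ 2 / ((b + 1) * (b + 2))
  let z : ℝ := (g + b + 3) ^ 2 / ((b + 1) * (b + 2))
  refine ⟨x, 1 - x - z, z, fun j => ?_⟩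
  have : (0 : ℝ) ≤ j := j.cast_nonneg
  have hj2 : (j : ℝ) + b + 2 ≠ 0 := by linarith
  have hj3 : (j : ℝ) + b + 3 ≠ 0 := by linarith
  have hj3' : ((j + 1 : ℕ) : ℝ) + b + 2 = j + b + 3 := by push_cast; ring
  rw [weightFactor_succ hb.le (j + 1), weightFactor_succ hb.le j, hj3', Nat.cast_add_one]
  simp only [x, z]
  field_simp
  ring

theorem exists_weight_combination_eq {n : ℕ} (hn : n ∉ hardyIndex β) (g : ℕ) :
    ∃ x y z : ℝ, ∀ κ : ℕ →₀ ℕ,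
      x * weight β κ + y * weight β (Finsupp.single n 1 + κ) +
          z * weight β (Finsupp.single n 2 + κ) =
        weight β κ * (((κ n : ℝ) - g) ^ 2 / ((κ n + β n + 2) * (κ n + β n + 3))) := by
  have hβ : (-1 : ℝ) ≤ β n := (β n).2
  obtain ⟨x, y, z, h⟩ := exists_weightFactor_combination_eq (lt_of_le_of_ne hβ (Ne.symm hn)) g
  refine ⟨x, y, z, fun κ => ?_⟩
  have hκ := (weightFactor_pos hβ (κ n)).ne'
  have h := h (κ n)
  rw [weight_single_add, weight_single_add, add_comm 1, add_comm 2]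
  field_simp
  rw [h]
  ring

theorem bergmanPart_eq_of_norm_smul_eq {K : A2 β} {γ : ℕ →₀ ℕ}
    (hK : ∀ p : MvPolynomial ℕ ℂ, ‖p • K‖ = ‖p • zetaPow β γ‖) {κ : ℕ →₀ ℕ}
    (hκ : coeff κ K.1 ≠ 0) : bergmanPart β κ = bergmanPart β γ := by
  ext n
  rw [bergmanPart_apply, bergmanPart_apply]
  split_ifs with hn
  · rfl
  obtain ⟨x, y, z, hxyz⟩ := exists_weight_combination_eq hn (γ n)
  have hsum (α : ℕ →₀ ℕ) :
      HasSum (fun κ => ‖coeff κ K.1‖ ^ 2 * weight β (α + κ)) (weight β (α + γ)) := by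
    rw [← norm_sq_zetaPow, ← mono_smul_zetaPow, ← hK]
    exact hasSum_norm_sq_mono_smul α K
  have hsum_zero : HasSum (fun κ => ‖coeff κ K.1‖ ^ 2 * (weight β κ *
      (((κ n : ℝ) - γ n) ^ 2 / ((κ n + β n + 2) * (κ n + β n + 3))))) 0 := by
    have h := (((hsum 0).mul_left x).add ((hsum (Finsupp.single n 1)).mul_left y)).add
      ((hsum (Finsupp.single n 2)).mul_left z)
    rw [zero_add, hxyz, sub_self, zero_pow two_ne_zero, zero_div, mul_zero] at h
    refine h.congr_fun fun κ => ?_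
    rw [← hxyz, zero_add]
    ring
  have hden (κ : ℕ →₀ ℕ) : 0 < ((κ n : ℝ) + β n + 2) * (κ n + β n + 3) := by
    have hβ : (-1 : ℝ) ≤ β n := (β n).2
    have : (0 : ℝ) ≤ κ n := (κ n).cast_nonneg
    exact mul_pos (by linarith) (by linarith)
  have hzero := congrFun ((hasSum_zero_iff_of_nonneg fun κ => mul_nonneg (sq_nonneg _)
    (mul_nonneg (weight_pos β κ).le (div_nonneg (sq_nonneg _) (hden κ).le))).1 hsum_zero) κ
  simpa [hκ, (weight_pos β κ).ne', (hden κ).ne', sub_eq_zero] using hzero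

theorem IsIsometricMultiplier.mem_hardySpace {F : A2 β} (hF : IsIsometricMultiplier F) :
    F ∈ hardySpace β :=
  mem_hardySpace_iff.2 fun _ hκ =>
    (bergmanPart_eq_of_norm_smul_eq (γ := 0) (zetaPow_zero (β := β) ▸ hF) hκ).trans
      (bergmanPart_zero β)

theorem exists_mem_hardySpace_eq_mono_smul {K : A2 β} {δ : ℕ →₀ ℕ}
    (hK : ∀ κ, coeff κ K.1 ≠ 0 → bergmanPart β κ = bergmanPart β δ) :
    ∃ F ∈ hardySpace β, K = mono (bergmanPart β δ) • F := by
  let F : MvPowerSeries ℕ ℂ := fun α => coeff (bergmanPart β δ + α) K.1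
  have coeff_F (α : ℕ →₀ ℕ) : coeff α F = coeff (bergmanPart β δ + α) K.1 := rfl
  have bergmanPart_eq_zero (α : ℕ →₀ ℕ) (hα : coeff α F ≠ 0) : bergmanPart β α = 0 := by
    have h := hK _ hα
    rw [bergmanPart_add, bergmanPart_bergmanPart] at h
    exact left_eq_add.1 h.symm
  have hF : F ∈ A2 β := by
    have hsum := ((norm_sq_eq β K).summable.comp_injective
      (add_right_injective (bergmanPart β δ))).mul_left (weight β δ)⁻¹
    refine hsum.congr fun α => ?_
    by_cases hα : coeff α F = 0
    · simp [← coeff_F, hα]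
    · have hα := bergmanPart_eq_zero α hα
      have hδ := (weight_pos β δ).ne'
      rw [Function.comp_apply, add_comm, weight_add_of_bergmanPart_eq_zero β hα,
        weight_of_bergmanPart_eq_zero β hα, weight_bergmanPart, coeff_F, add_comm]
      field_simp
  refine ⟨⟨F, hF⟩, mem_hardySpace_iff.2 bergmanPart_eq_zero,
    Subtype.ext (MvPowerSeries.ext fun κ => ?_)⟩
  by_cases hκ : bergmanPart β δ ≤ κ
  · obtain ⟨α, rfl⟩ := exists_add_of_le hκ
    rw [coeff_add_mono_smul, coeff_F]
  · rw [coe_mono_smul, MvPowerSeries.coeff_monomial_mul, if_neg hκ]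
    contrapose! hκ
    exact hK κ hκ ▸ bergmanPart_le β κ

theorem exists_eq_mulLeft_of_norm_smul_eq {K : A2 β} {γ : ℕ →₀ ℕ}
    (hK : ∀ p : MvPolynomial ℕ ℂ, ‖p • K‖ = ‖p • zetaPow β γ‖) :
    ∃ (F : A2 β) (hF : IsIsometricMultiplier F),
      K = hF.mulLeft (zetaPow β (bergmanPart β γ)) := by
  obtain ⟨F, hF, rfl⟩ := exists_mem_hardySpace_eq_mono_smul
    fun _ => bergmanPart_eq_of_norm_smul_eq hK
  have hF' : IsIsometricMultiplier F := by
    refine isIsometricMultiplier_of_inner_mono_smul hF fun α δ hα _ => ?_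
    have h := inner_smul_smul_eq_of_norm_smul_eq (𝕜 := ℂ) hK (mono α) (mono δ)
    rw [zetaPow, smul_comm (mono α), smul_comm (mono δ), smul_comm (mono α), smul_comm (mono δ),
      inner_mono_smul_mono_smul_self (mono_smul_mem_hardySpace hα hF),
      inner_mono_smul_mono_smul_self (mono_smul_mem_hardySpace hα one_mem_hardySpace),
      weight_bergmanPart] at h
    exact mul_left_cancel₀ (by exact_mod_cast (weight_pos β γ).ne') h
  exact ⟨F, hF', (hF'.mulLeft_zetaPow _).symm⟩

end Rigidity

section Measures

theorem integral_monoidHom_eq_zero {G : Type*} [Group G] [MeasurableSpace G] [MeasurableMul G]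
    (μ : Measure G) [μ.IsMulLeftInvariant] {χ : G →* ℂ} (hχ : χ ≠ 1) : ∫ t, χ t ∂μ = 0 := by
  obtain ⟨s, hs⟩ := DFunLike.ne_iff.1 hχ
  have h := integral_mul_left_eq_self (μ := μ) χ s
  simp only [map_mul] at h
  rw [integral_const_mul] at h
  by_contra hne
  exact hs ((mul_eq_right₀ hne).1 h)

theorem ext_of_integral_eq_on_submonoid {X : Type*} [TopologicalSpace X] [PolishSpace X]
    [MeasurableSpace X] [BorelSpace X] {μ ν : Measure X} [IsFiniteMeasure μ] [IsFiniteMeasure ν]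
    (S : Submonoid (BoundedContinuousFunction X ℂ)) (hstar : ∀ f ∈ S, star f ∈ S)
    (hsep : ∀ s t, s ≠ t → ∃ f ∈ S, f s ≠ f t) (h : ∀ f ∈ S, ∫ x, f x ∂μ = ∫ x, f x ∂ν) :
    μ = ν := by
  refine ext_of_forall_mem_subalgebra_integral_eq_of_polish (𝕜 := ℂ)
    (A := StarAlgebra.adjoin ℂ (S : Set (BoundedContinuousFunction X ℂ))) ?_ fun f hf => ?_
  · intro s t hst
    obtain ⟨f, hf, hne⟩ := hsep s t hst
    exact ⟨f, ⟨f, ⟨f, StarAlgebra.subset_adjoin ℂ _ hf, rfl⟩, rfl⟩, hne⟩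
  have hS : star (S : Set (BoundedContinuousFunction X ℂ)) ⊆ S := fun f hf => by
    simpa using hstar _ hf
  rw [← StarSubalgebra.mem_toSubalgebra, StarAlgebra.adjoin_toSubalgebra,
    Set.union_eq_left.2 hS, ← Subalgebra.mem_toSubmodule, Algebra.adjoin_eq_span,
    Submonoid.closure_eq] at hf
  induction hf using Submodule.span_induction with
  | mem f hf => exact h f hf
  | zero => simp
  | add f g _ _ hf hg =>
    simp only [BoundedContinuousFunction.add_apply]
    rw [integral_add (f.integrable μ) (g.integrable μ),
      integral_add (f.integrable ν) (g.integrable ν), hf, hg]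
  | smul c f _ hf =>
    simp only [BoundedContinuousFunction.smul_apply]
    rw [integral_smul, integral_smul, hf]

theorem ae_norm_eq_one_of_withDensity_eq {X E : Type*} [MeasurableSpace X]
    [NormedAddCommGroup E] {μ : Measure X} [SigmaFinite μ] {f : X → E}
    (hf : AEStronglyMeasurable f μ)
    (h : μ.withDensity (fun t => ((‖f t‖₊ ^ 2 : NNReal) : ENNReal)) = μ) :
    ∀ᵐ t ∂μ, ‖f t‖ = 1 := by
  have h1 : μ.withDensity (fun t => ((‖f t‖₊ ^ 2 : NNReal) : ENNReal)) =
      μ.withDensity fun _ => 1 := by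
    rw [h, withDensity_const, one_smul]
  rw [withDensity_eq_iff_of_sigmaFinite (hf.nnnorm.aemeasurable.pow_const 2).coe_nnreal_ennreal
    aemeasurable_const] at h1
  filter_upwards [h1] with t ht
  have ht : ‖f t‖₊ ^ 2 = 1 := ENNReal.coe_eq_one.1 ht
  exact congrArg NNReal.toReal ((pow_eq_one_iff_of_nonneg zero_le two_ne_zero).1 ht)

end Measures

section TorusMonomials

variable (β : ℕ → Set.Ici (-1 : ℝ))

theorem torusPoint_of_mem {β : ℕ → Set.Ici (-1 : ℝ)} (t : torus β) {n : ℕ}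
    (hn : n ∈ hardyIndex β) : torusPoint t n = t ⟨n, hn⟩ :=
  dif_pos hn

theorem torusPoint_of_notMem {β : ℕ → Set.Ici (-1 : ℝ)} (t : torus β) {n : ℕ}
    (hn : n ∉ hardyIndex β) : torusPoint t n = 1 :=
  dif_neg hn

theorem torusPoint_mul {β : ℕ → Set.Ici (-1 : ℝ)} (s t : torus β) (n : ℕ) :
    torusPoint (s * t) n = torusPoint s n * torusPoint t n := by
  by_cases hn : n ∈ hardyIndex β
  · simp only [torusPoint_of_mem _ hn, Pi.mul_apply]
  · simp only [torusPoint_of_notMem _ hn, mul_one]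

theorem torusMonomial_apply (α : ℕ →₀ ℕ) (t : torus β) :
    torusMonomial β α t = α.prod fun n k => (torusPoint t n : ℂ) ^ k :=
  rfl

theorem torusMonomial_zero : torusMonomial β 0 = 1 :=
  rfl

theorem torusMonomial_add (α δ : ℕ →₀ ℕ) :
    torusMonomial β (α + δ) = torusMonomial β α * torusMonomial β δ := by
  ext t
  exact Finsupp.prod_add_index' (fun _ => pow_zero _) fun _ _ _ => pow_add _ _ _

theorem torusMonomial_apply_one (α : ℕ →₀ ℕ) : torusMonomial β α 1 = 1 := by
  simp [torusMonomial_apply, torusPoint]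

theorem torusMonomial_apply_mul (α : ℕ →₀ ℕ) (s t : torus β) :
    torusMonomial β α (s * t) = torusMonomial β α s * torusMonomial β α t := by
  simp only [torusMonomial_apply, Finsupp.prod, torusPoint_mul, Circle.coe_mul, mul_pow,
    Finset.prod_mul_distrib]

theorem torusMonomial_single (n : ℕ) (k : ℕ) (t : torus β) :
    torusMonomial β (Finsupp.single n k) t = (torusPoint t n : ℂ) ^ k :=
  Finsupp.prod_single_index (h := fun m k => (torusPoint t m : ℂ) ^ k) (pow_zero _)

theorem torusMonomial_mulSingle (α : ℕ →₀ ℕ) {n : ℕ} (hn : n ∈ hardyIndex β) (z : Circle) :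
    torusMonomial β α (Pi.mulSingle ⟨n, hn⟩ z) = (z : ℂ) ^ α n := by
  have hself : torusPoint (Pi.mulSingle ⟨n, hn⟩ z : torus β) n = z := by
    rw [torusPoint_of_mem _ hn, Pi.mulSingle_eq_same]
  rw [torusMonomial_apply, Finsupp.prod, Finset.prod_eq_single n (fun m _ hm => ?_)
    (fun hα => by rw [Finsupp.notMem_support_iff.1 hα, pow_zero]), hself]
  by_cases hmH : m ∈ hardyIndex β
  · rw [torusPoint_of_mem _ hmH, Pi.mulSingle_eq_of_ne (by simpa using hm), Circle.coe_one,
      one_pow]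
  · rw [torusPoint_of_notMem _ hmH, Circle.coe_one, one_pow]

theorem norm_torusMonomial (α : ℕ →₀ ℕ) (t : torus β) : ‖torusMonomial β α t‖ = 1 := by
  rw [torusMonomial_apply, Finsupp.prod, norm_prod]
  exact Finset.prod_eq_one fun n _ => by rw [norm_pow, Circle.norm_coe, one_pow]

theorem conj_mul_torusMonomial_self (α : ℕ →₀ ℕ) (t : torus β) :
    conj (torusMonomial β α t) * torusMonomial β α t = 1 := by
  rw [Complex.conj_mul', norm_torusMonomial, Complex.ofReal_one, one_pow]

theorem torusMonomial_hardyPart (α : ℕ →₀ ℕ) :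
    torusMonomial β (hardyPart β α) = torusMonomial β α := by
  have h : torusMonomial β (bergmanPart β α) = 1 := by
    ext t
    rw [torusMonomial_apply]
    refine Finset.prod_eq_one fun n _ => ?_
    by_cases hn : n ∈ hardyIndex β
    · simp only [bergmanPart_apply, if_pos hn, pow_zero]
    · simp only [torusPoint_of_notMem t hn, Circle.coe_one, one_pow]
  rw [← mul_one (torusMonomial β (hardyPart β α)), ← h, ← torusMonomial_add,
    hardyPart_add_bergmanPart]

instance : (torusHaar β).IsMulLeftInvariant := by
  unfold torusHaar
  infer_instance

instance : PolishSpace (torus β) := by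
  let := TopologicalSpace.metrizableSpaceMetric (torus β)
  infer_instance

variable {β}

theorem exists_mem_hardyIndex_ne {α δ : ℕ →₀ ℕ} (hα : bergmanPart β α = 0)
    (hδ : bergmanPart β δ = 0) (hne : α ≠ δ) : ∃ n ∈ hardyIndex β, α n ≠ δ n := by
  obtain ⟨n, hn⟩ := DFunLike.ne_iff.1 hne
  refine ⟨n, by_contra fun hnH => hn ?_, hn⟩
  have h := DFunLike.congr_fun (hα.trans hδ.symm) n
  simpa only [bergmanPart_apply, if_neg hnH] using h

theorem exists_circle_pow_ne {k l : ℕ} (h : k ≠ l) : ∃ z : Circle, (z : ℂ) ^ k ≠ (z : ℂ) ^ l := by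
  have hlk : (l : ℂ) - k ≠ 0 := sub_ne_zero.2 (by exact_mod_cast h.symm)
  refine ⟨Circle.exp (Real.pi / (l - k)), ?_⟩
  rw [Circle.coe_exp, ← Complex.exp_nat_mul, ← Complex.exp_nat_mul]
  have hl : (l : ℂ) * ((Real.pi / (l - k) : ℝ) * Complex.I) =
      k * ((Real.pi / (l - k) : ℝ) * Complex.I) + Real.pi * Complex.I := by
    push_cast
    field_simp
    ring
  rw [hl, Complex.exp_add, Complex.exp_pi_mul_I, mul_neg_one]
  exact self_ne_neg.2 (Complex.exp_ne_zero _)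

theorem integral_conj_mul_torusMonomial {α δ : ℕ →₀ ℕ} (hα : bergmanPart β α = 0)
    (hδ : bergmanPart β δ = 0) :
    ∫ t, conj (torusMonomial β α t) * torusMonomial β δ t ∂torusHaar β =
      if α = δ then 1 else 0 := by
  split_ifs with h
  · subst h
    simp [conj_mul_torusMonomial_self]
  · let χ : torus β →* ℂ :=
      { toFun := fun t => conj (torusMonomial β α t) * torusMonomial β δ t
        map_one' := by simp [torusMonomial_apply_one]
        map_mul' := fun s t => by
          rw [torusMonomial_apply_mul, torusMonomial_apply_mul, map_mul, mul_mul_mul_comm] }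
    obtain ⟨n, hn, hne⟩ := exists_mem_hardyIndex_ne hα hδ h
    obtain ⟨z, hz⟩ := exists_circle_pow_ne hne
    refine integral_monoidHom_eq_zero (torusHaar β) (χ := χ) fun hχ => hz ?_
    have h1 := DFunLike.congr_fun hχ (Pi.mulSingle ⟨n, hn⟩ z)
    have h2 := conj_mul_torusMonomial_self β α (Pi.mulSingle ⟨n, hn⟩ z)
    rw [← torusMonomial_mulSingle β α hn, ← torusMonomial_mulSingle β δ hn]
    exact mul_left_cancel₀ (left_ne_zero_of_mul_eq_one h2) (h2.trans h1.symm)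

theorem measure_ext_of_fourierCoeff {μ ν : Measure (torus β)} [IsFiniteMeasure μ]
    [IsFiniteMeasure ν]
    (h : ∀ α δ, bergmanPart β α = 0 → bergmanPart β δ = 0 →
      ∫ t, conj (torusMonomial β α t) * torusMonomial β δ t ∂μ =
        ∫ t, conj (torusMonomial β α t) * torusMonomial β δ t ∂ν) : μ = ν := by
  let S : Submonoid (BoundedContinuousFunction (torus β) ℂ) :=
    { carrier := {f | ∃ α δ, ∀ t, f t = conj (torusMonomial β α t) * torusMonomial β δ t}
      one_mem' := ⟨0, 0, fun t => by simp [torusMonomial_zero]⟩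
      mul_mem' := by
        rintro f g ⟨α, δ, hf⟩ ⟨α', δ', hg⟩
        refine ⟨α + α', δ + δ', fun t => ?_⟩
        rw [BoundedContinuousFunction.mul_apply, hf, hg, torusMonomial_add, torusMonomial_add,
          ContinuousMap.mul_apply, ContinuousMap.mul_apply, map_mul, mul_mul_mul_comm] }
  refine ext_of_integral_eq_on_submonoid S ?_ ?_ ?_
  · rintro f ⟨α, δ, hf⟩
    exact ⟨δ, α, fun t => by
      rw [BoundedContinuousFunction.star_apply, hf, star_mul, starRingEnd_apply, star_star,
        starRingEnd_apply]⟩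
  · intro s t hst
    obtain ⟨⟨n, hn⟩, hne⟩ := Function.ne_iff.1 hst
    refine ⟨BoundedContinuousFunction.mkOfCompact (torusMonomial β (Finsupp.single n 1)),
      ⟨0, Finsupp.single n 1, fun r => by simp [torusMonomial_zero]⟩, fun heq => hne ?_⟩
    simp only [BoundedContinuousFunction.mkOfCompact_apply, torusMonomial_single, pow_one,
      torusPoint_of_mem _ hn] at heq
    exact Circle.coe_injective heq
  · rintro f ⟨α, δ, hf⟩
    simp only [hf, ← torusMonomial_hardyPart β α, ← torusMonomial_hardyPart β δ]
    exact h _ _ (bergmanPart_hardyPart β α) (bergmanPart_hardyPart β δ)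

end TorusMonomials

section BoundaryFunctions

variable {β : ℕ → Set.Ici (-1 : ℝ)}

theorem inner_toLp_torusMonomial {α δ : ℕ →₀ ℕ} (hα : bergmanPart β α = 0)
    (hδ : bergmanPart β δ = 0) :
    inner ℂ (ContinuousMap.toLp (E := ℂ) 2 (torusHaar β) ℂ (torusMonomial β α))
      (ContinuousMap.toLp (E := ℂ) 2 (torusHaar β) ℂ (torusMonomial β δ)) =
        if α = δ then (1 : ℂ) else 0 := by
  rw [ContinuousMap.inner_toLp, ← integral_conj_mul_torusMonomial hα hδ]
  exact integral_congr_ae (.of_forall fun t => mul_comm _ _)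

theorem exists_isBoundaryFunction {F : A2 β} (hF : F ∈ hardySpace β) :
    ∃ f : Lp ℂ 2 (torusHaar β), IsBoundaryFunction F f := by
  let S : Set (ℕ →₀ ℕ) := {α | bergmanPart β α = 0}
  have hon : Orthonormal ℂ fun α : S =>
      ContinuousMap.toLp (E := ℂ) 2 (torusHaar β) ℂ (torusMonomial β α) := by
    classical
    rw [orthonormal_iff_ite]
    intro α δ
    rw [inner_toLp_torusMonomial α.2 δ.2]
    simp only [Subtype.ext_iff]
  have hsq : Summable fun α : S => ‖coeff α F.1‖ ^ 2 := by
    refine ((norm_sq_eq β F).summable.comp_injective Subtype.val_injective).congr fun α => ?_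
    rw [Function.comp_apply, weight_of_bergmanPart_eq_zero β α.2, mul_one]
  have hsum := (hon.orthogonalFamily.summable_iff_norm_sq_summable
    fun α : S => coeff α.1 F.1).2 hsq
  refine ⟨_, (Subtype.val_injective.hasSum_iff fun α hα => ?_).1 hsum.hasSum⟩
  by_cases h : coeff α F.1 = 0
  · rw [h, zero_smul]
  · exact absurd ⟨⟨α, mem_hardySpace_iff.1 hF α h⟩, rfl⟩ hα

theorem IsBoundaryFunction.inner_torusMonomial {F : A2 β} (hF : F ∈ hardySpace β)
    {f : Lp ℂ 2 (torusHaar β)} (hf : IsBoundaryFunction F f) {α : ℕ →₀ ℕ}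
    (hα : bergmanPart β α = 0) :
    inner ℂ (ContinuousMap.toLp (E := ℂ) 2 (torusHaar β) ℂ (torusMonomial β α)) f =
      coeff α F.1 := by
  refine ((innerSL ℂ _).hasSum hf).unique ((hasSum_ite_eq α (coeff α F.1)).congr_fun fun κ => ?_)
  rw [innerSL_apply_apply, inner_smul_right]
  by_cases hκ : coeff κ F.1 = 0
  · rw [hκ, zero_mul, eq_comm, ite_eq_right_iff]
    rintro rfl
    exact hκ
  · rw [inner_toLp_torusMonomial hα (mem_hardySpace_iff.1 hF κ hκ)]
    by_cases h : κ = α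
    · rw [if_pos h.symm, if_pos h, h, mul_one]
    · rw [if_neg (Ne.symm h), if_neg h, mul_zero]

theorem IsBoundaryFunction.inner_eq {F G : A2 β} (hF : F ∈ hardySpace β) (hG : G ∈ hardySpace β)
    {f g : Lp ℂ 2 (torusHaar β)} (hf : IsBoundaryFunction F f) (hg : IsBoundaryFunction G g) :
    inner ℂ f g = inner ℂ F G := by
  refine ((innerSL ℂ f).hasSum hg).unique ((hasSum_inner F G).congr_fun fun α => ?_)
  rw [innerSL_apply_apply, inner_smul_right]
  by_cases h : coeff α G.1 = 0
  · simp only [h, mul_zero, zero_mul]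
  · have hα := mem_hardySpace_iff.1 hG α h
    rw [← inner_conj_symm, hf.inner_torusMonomial hF hα, weight_of_bergmanPart_eq_zero β hα,
      Complex.ofReal_one, mul_one, mul_comm]

/-- Multiplication by `ζ^α` on `L²(𝕋^H)`. -/
def torusMul (α : ℕ →₀ ℕ) : Lp ℂ 2 (torusHaar β) →L[ℂ] Lp ℂ 2 (torusHaar β) :=
  (ContinuousLinearMap.mul ℂ ℂ).holderL (torusHaar β) ⊤ 2 2
    (ContinuousMap.toLp (E := ℂ) ⊤ (torusHaar β) ℂ (torusMonomial β α))

theorem coeFn_torusMul (α : ℕ →₀ ℕ) (f : Lp ℂ 2 (torusHaar β)) :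
    torusMul α f =ᵐ[torusHaar β] fun t => torusMonomial β α t * f t := by
  filter_upwards [(ContinuousLinearMap.mul ℂ ℂ).coeFn_holder (r := 2)
      (ContinuousMap.toLp (E := ℂ) ⊤ (torusHaar β) ℂ (torusMonomial β α)) f,
    ContinuousMap.coeFn_toLp (p := ⊤) (𝕜 := ℂ) (torusHaar β) (torusMonomial β α)] with t h1 h2
  rw [h2] at h1
  exact h1

theorem torusMul_torusMonomial (α κ : ℕ →₀ ℕ) :
    torusMul α (ContinuousMap.toLp (E := ℂ) 2 (torusHaar β) ℂ (torusMonomial β κ)) =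
      ContinuousMap.toLp (E := ℂ) 2 (torusHaar β) ℂ (torusMonomial β (α + κ)) := by
  refine Lp.ext ?_
  filter_upwards [coeFn_torusMul α
      (ContinuousMap.toLp (E := ℂ) 2 (torusHaar β) ℂ (torusMonomial β κ)),
    ContinuousMap.coeFn_toLp (p := 2) (𝕜 := ℂ) (torusHaar β) (torusMonomial β κ),
    ContinuousMap.coeFn_toLp (p := 2) (𝕜 := ℂ) (torusHaar β) (torusMonomial β (α + κ))]
    with t h1 h2 h3
  rw [h1, h2, h3, torusMonomial_add, ContinuousMap.mul_apply]

theorem IsBoundaryFunction.mono_smul {F : A2 β} {f : Lp ℂ 2 (torusHaar β)}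
    (hf : IsBoundaryFunction F f) (α : ℕ →₀ ℕ) :
    IsBoundaryFunction (mono α • F) (torusMul α f) := by
  rw [IsBoundaryFunction, ← (add_right_injective α).hasSum_iff fun κ hκ => ?_]
  · refine ((torusMul α).hasSum hf).congr_fun fun κ => ?_
    rw [Function.comp_apply, coeff_add_mono_smul, map_smul, torusMul_torusMonomial]
  · by_contra hne
    obtain ⟨τ, rfl, -⟩ := exists_add_of_coeff_mono_smul_ne_zero (left_ne_zero_of_smul hne)
    exact hκ ⟨τ, rfl⟩

theorem IsBoundaryFunction.inner_mono_smul {F : A2 β} (hF : F ∈ hardySpace β)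
    {f : Lp ℂ 2 (torusHaar β)} (hf : IsBoundaryFunction F f) {α δ : ℕ →₀ ℕ}
    (hα : bergmanPart β α = 0) (hδ : bergmanPart β δ = 0) :
    inner ℂ (mono α • F) (mono δ • F) =
      ∫ t, (‖f t‖₊ ^ 2) • (conj (torusMonomial β α t) * torusMonomial β δ t) ∂torusHaar β := by
  rw [← IsBoundaryFunction.inner_eq (mono_smul_mem_hardySpace hα hF)
    (mono_smul_mem_hardySpace hδ hF) (hf.mono_smul α) (hf.mono_smul δ), L2.inner_def]
  refine integral_congr_ae ?_
  filter_upwards [coeFn_torusMul α f, coeFn_torusMul δ f] with t hα hδ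
  have hsq : conj (f t) * f t = (‖f t‖ : ℂ) ^ 2 := Complex.conj_mul' _
  rw [hα, hδ, RCLike.inner_apply, map_mul, NNReal.smul_def, NNReal.coe_pow, coe_nnnorm,
    Complex.real_smul, Complex.ofReal_pow, ← hsq]
  ring

theorem inner_mono_smul_one {α δ : ℕ →₀ ℕ} (hα : bergmanPart β α = 0) :
    inner ℂ (mono α • one β) (mono δ • one β) = if α = δ then 1 else 0 := by
  change inner ℂ (zetaPow β α) (zetaPow β δ) = _
  rw [inner_zetaPow_left, weight_of_bergmanPart_eq_zero β hα, coeff_zetaPow, Complex.ofReal_one,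
    one_mul]

theorem IsInner.isIsometricMultiplier {F : A2 β} (hF : IsInner F) :
    IsIsometricMultiplier F := by
  obtain ⟨f, hf, hnorm⟩ := hF.boundary
  refine isIsometricMultiplier_of_inner_mono_smul hF.mem_hardySpace fun α δ hα hδ => ?_
  rw [hf.inner_mono_smul hF.mem_hardySpace hα hδ, inner_mono_smul_one hα,
    ← integral_conj_mul_torusMonomial hα hδ]
  refine integral_congr_ae ?_
  filter_upwards [hnorm] with t ht
  rw [show ‖f t‖₊ = 1 from NNReal.eq ht, one_pow, one_smul]

theorem IsIsometricMultiplier.ae_norm_boundary_eq_one {F : A2 β} (hF : IsIsometricMultiplier F)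
    {f : Lp ℂ 2 (torusHaar β)} (hf : IsBoundaryFunction F f) :
    ∀ᵐ t ∂torusHaar β, ‖f t‖ = 1 := by
  have hmeas : Measurable fun t => ‖f t‖₊ ^ 2 :=
    (Lp.stronglyMeasurable f).measurable.nnnorm.pow_const 2
  have hfin : ∫⁻ t, ((‖f t‖₊ ^ 2 : NNReal) : ENNReal) ∂torusHaar β ≠ ⊤ := by
    simpa [enorm_eq_nnnorm] using ((Lp.memLp f).integrable_norm_pow two_ne_zero).2.ne
  have : IsFiniteMeasure ((torusHaar β).withDensity
      fun t => ((‖f t‖₊ ^ 2 : NNReal) : ENNReal)) := isFiniteMeasure_withDensity hfin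
  refine ae_norm_eq_one_of_withDensity_eq (Lp.aestronglyMeasurable f)
    (measure_ext_of_fourierCoeff fun α δ hα hδ => ?_)
  rw [integral_withDensity_eq_integral_smul hmeas, ← hf.inner_mono_smul hF.mem_hardySpace hα hδ,
    inner_smul_smul_eq_of_norm_smul_eq hF, inner_mono_smul_one hα,
    integral_conj_mul_torusMonomial hα hδ]

end BoundaryFunctions

section Evaluation

theorem sum_finsupp_prod_pow (s : Finset ℕ) (N : ℕ) (x : ℕ → ℝ) :
    ∑ α ∈ s.finsupp fun _ => Finset.range N, α.prod (fun n k => x n ^ k) =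
      ∏ n ∈ s, ∑ k ∈ Finset.range N, x n ^ k := by
  rw [Finset.prod_sum, Finset.finsupp, Finset.sum_map]
  refine Finset.sum_congr (by congr!) fun p _ => ?_
  rw [Function.Embedding.coeFn_mk, Finsupp.prod_of_support_subset _
    (Finsupp.support_indicator_subset _ _) _ fun _ _ => pow_zero _, ← Finset.prod_attach]
  exact Finset.prod_congr rfl fun n _ => by rw [Finsupp.indicator_of_mem n.2]

theorem sum_range_pow_le_exp {x : ℝ} (h0 : 0 ≤ x) (h1 : x < 1) (N : ℕ) :
    ∑ k ∈ Finset.range N, x ^ k ≤ Real.exp (x / (1 - x)) := by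
  have hx : 1 - x ≠ 0 := (sub_pos.2 h1).ne'
  calc ∑ k ∈ Finset.range N, x ^ k ≤ (1 - x)⁻¹ :=
        sum_le_hasSum _ (fun k _ => pow_nonneg h0 k) (hasSum_geometric_of_lt_one h0 h1)
    _ = x / (1 - x) + 1 := by field_simp; ring
    _ ≤ Real.exp (x / (1 - x)) := Real.add_one_le_exp _

theorem summable_finsupp_prod_pow {x : ℕ → ℝ} (h0 : ∀ n, 0 ≤ x n) (h1 : ∀ n, x n < 1)
    (hx : Summable x) : Summable fun α : ℕ →₀ ℕ => α.prod fun n k => x n ^ k := by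
  classical
  have hy : Summable fun n => x n / (1 - x n) := by
    refine Summable.mul_tendsto_const (c := (1 - 0)⁻¹) (by simpa using hx.abs) ?_
    exact (tendsto_const_nhds.sub hx.tendsto_cofinite_zero).inv₀ (by norm_num)
  have hy0 (n : ℕ) : 0 ≤ x n / (1 - x n) := div_nonneg (h0 n) (sub_nonneg.2 (h1 n).le)
  have hnonneg (α : ℕ →₀ ℕ) : 0 ≤ α.prod fun n k => x n ^ k :=
    Finset.prod_nonneg fun n _ => pow_nonneg (h0 n) _
  refine summable_of_sum_le (c := Real.exp (∑' n, x n / (1 - x n))) hnonneg fun T => ?_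
  let b : ℕ →₀ ℕ := T.sup id
  let s : Finset ℕ := b.support
  let N : ℕ := s.sup b + 1
  have hT : T ⊆ s.finsupp fun _ => Finset.range N := fun α hα => by
    have hle : α ≤ b := Finset.le_sup (f := id) hα
    refine Finset.mem_finsupp_iff.2 ⟨Finsupp.support_mono hle, fun n hn => ?_⟩
    exact Finset.mem_range.2 (Nat.lt_succ_of_le ((hle n).trans (Finset.le_sup hn)))
  calc ∑ α ∈ T, α.prod (fun n k => x n ^ k)
      ≤ ∑ α ∈ s.finsupp fun _ => Finset.range N, α.prod (fun n k => x n ^ k) :=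
        Finset.sum_le_sum_of_subset_of_nonneg hT fun α _ _ => hnonneg α
    _ = ∏ n ∈ s, ∑ k ∈ Finset.range N, x n ^ k := sum_finsupp_prod_pow s N x
    _ ≤ ∏ n ∈ s, Real.exp (x n / (1 - x n)) :=
        Finset.prod_le_prod (fun n _ => Finset.sum_nonneg fun k _ => pow_nonneg (h0 n) k)
          fun n _ => sum_range_pow_le_exp (h0 n) (h1 n) N
    _ = Real.exp (∑ n ∈ s, x n / (1 - x n)) := (Real.exp_sum s _).symm
    _ ≤ Real.exp (∑' n, x n / (1 - x n)) :=
        Real.exp_le_exp.2 (hy.sum_le_tsum s fun n _ => hy0 n)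

variable {β : ℕ → Set.Ici (-1 : ℝ)} {z : ℕ → ℂ}

theorem prod_pow_eq_zero_or_weight_eq_one (hz : z ∈ hardyDisk β) (α : ℕ →₀ ℕ) :
    (α.prod fun n k => z n ^ k) = 0 ∨ weight β α = 1 := by
  by_cases hα : bergmanPart β α = 0
  · exact .inr (weight_of_bergmanPart_eq_zero β hα)
  · rw [bergmanPart_eq_zero_iff, Set.not_subset] at hα
    obtain ⟨n, hn, hnH⟩ := hα
    refine .inl (Finset.prod_eq_zero hn ?_)
    simp only [hz.2.2 n hnH, zero_pow (Finsupp.mem_support_iff.1 hn)]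

/-- The reproducing kernel `∑ conj z^α ζ^α` of the Hardy space at the point `z` of `𝔻₂^H`. -/
def szegoKernel (hz : z ∈ hardyDisk β) : A2 β :=
  ⟨fun α => conj (α.prod fun n k => z n ^ k), by
    refine (summable_finsupp_prod_pow (fun n => sq_nonneg ‖z n‖)
      (fun n => pow_lt_one₀ (norm_nonneg _) (hz.2.1 n) two_ne_zero) hz.1).congr fun α => ?_
    change _ = ‖conj (α.prod fun n k => z n ^ k)‖ ^ 2 * weight β α
    have hnorm : ‖α.prod fun n k => z n ^ k‖ ^ 2 = α.prod fun n k => (‖z n‖ ^ 2) ^ k := by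
      simp only [Finsupp.prod, norm_prod, norm_pow, ← Finset.prod_pow, pow_right_comm]
    rw [RCLike.norm_conj, ← hnorm]
    rcases prod_pow_eq_zero_or_weight_eq_one hz α with h | h
    · rw [h, norm_zero, zero_pow two_ne_zero, zero_mul]
    · rw [h, mul_one]⟩

theorem coeff_szegoKernel (hz : z ∈ hardyDisk β) (α : ℕ →₀ ℕ) :
    coeff α (szegoKernel hz).1 = conj (α.prod fun n k => z n ^ k) :=
  rfl

theorem hasSum_evalAt (hz : z ∈ hardyDisk β) (G : A2 β) :
    HasSum (fun α : ℕ →₀ ℕ => coeff α G.1 * α.prod fun n k => z n ^ k)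
      (inner ℂ (szegoKernel hz) G) := by
  refine (hasSum_inner (szegoKernel hz) G).congr_fun fun α => ?_
  rw [coeff_szegoKernel, Complex.conj_conj]
  rcases prod_pow_eq_zero_or_weight_eq_one hz α with h | h
  · rw [h, mul_zero, zero_mul, zero_mul]
  · rw [h, Complex.ofReal_one, mul_one, mul_comm]

theorem inner_szegoKernel (hz : z ∈ hardyDisk β) (G : A2 β) :
    inner ℂ (szegoKernel hz) G = evalAt G z :=
  (hasSum_evalAt hz G).tsum_eq.symm

theorem evalAt_mul (hz : z ∈ hardyDisk β) (F G : A2 β) :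
    evalAt (F.1 * G.1) z = evalAt F z * evalAt G z := by
  have cauchy {f g : (ℕ →₀ ℕ) → ℂ} (hf : Summable f) (hg : Summable g) :
      (∑' α, f α) * ∑' α, g α =
        ∑' κ, ∑ x ∈ Finset.HasAntidiagonal.antidiagonal κ, f x.1 * g x.2 :=
    hf.tsum_mul_tsum_eq_tsum_sum_antidiagonal hg
      (summable_mul_of_summable_norm hf.norm hg.norm)
  simp only [evalAt]
  rw [cauchy (hasSum_evalAt hz F).summable (hasSum_evalAt hz G).summable]
  refine tsum_congr fun κ => ?_
  rw [MvPowerSeries.coeff_mul, Finset.sum_mul]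
  refine Finset.sum_congr rfl fun x hx => ?_
  rw [← Finset.HasAntidiagonal.mem_antidiagonal.1 hx,
    Finsupp.prod_add_index' (fun _ => pow_zero _) fun _ _ _ => pow_add _ _ _, mul_mul_mul_comm]

theorem szegoKernel_ne_zero (hz : z ∈ hardyDisk β) : szegoKernel hz ≠ 0 := fun h => by
  have h0 : coeff 0 (szegoKernel hz).1 = 0 := by rw [h]; rfl
  rw [coeff_szegoKernel, Finsupp.prod_zero_index, map_one] at h0
  exact one_ne_zero h0

theorem IsIsometricMultiplier.norm_evalAt_le_one {F : A2 β} (hF : IsIsometricMultiplier F)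
    (hz : z ∈ hardyDisk β) : ‖evalAt F z‖ ≤ 1 := by
  let k := szegoKernel hz
  have hk : 0 < ‖k‖ ^ 2 := pow_pos (norm_pos_iff.2 (szegoKernel_ne_zero hz)) 2
  refine (mul_le_iff_le_one_left hk).1 ?_
  calc ‖evalAt F z‖ * ‖k‖ ^ 2 = ‖inner ℂ k (hF.mulLeft k)‖ := by
        rw [inner_szegoKernel, coe_mulLeft, evalAt_mul hz, ← inner_szegoKernel hz k, norm_mul,
          inner_self_eq_norm_sq_to_K, norm_pow, RCLike.norm_ofReal, abs_norm]
    _ ≤ ‖k‖ * ‖hF.mulLeft k‖ := norm_inner_le_norm _ _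
    _ = ‖k‖ ^ 2 := by rw [hF.mulLeft.norm_map, sq]

theorem isIsometricMultiplier_iff_isInner {F : A2 β} : IsIsometricMultiplier F ↔ IsInner F := by
  refine ⟨fun hF => ?_, IsInner.isIsometricMultiplier⟩
  obtain ⟨f, hf⟩ := exists_isBoundaryFunction hF.mem_hardySpace
  exact ⟨hF.mem_hardySpace, ⟨1, fun z hz => hF.norm_evalAt_le_one hz⟩, f, hf,
    hF.ae_norm_boundary_eq_one hf⟩

end Evaluation

end WeightedBergman

end

theorem theorem4p3 (β : ℕ → Set.Ici (-1 : ℝ)) (γ : ℕ →₀ ℕ) :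
    WeightedBergman.seriesSet ''
        WeightedBergman.unitaryOrbit
          (WeightedBergman.generated β {WeightedBergman.zetaPow β γ}) =
      {S : Set (MvPowerSeries ℕ ℂ) | ∃ F : WeightedBergman.A2 β, WeightedBergman.IsInner F ∧
        S = (fun G : MvPowerSeries ℕ ℂ => (F : MvPowerSeries ℕ ℂ) * G) ''
          WeightedBergman.seriesSet (WeightedBergman.generated β
            {WeightedBergman.zetaPow β (WeightedBergman.bergmanPart β γ)})} := by
  ext S
  constructor
  · rintro ⟨N, ⟨U, hU⟩, rfl⟩
    obtain ⟨K, rfl, hK⟩ := WeightedBergman.exists_eq_closure_span_singleton_of_equiv ⟨U, hU⟩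
    obtain ⟨F, hF, rfl⟩ := WeightedBergman.exists_eq_mulLeft_of_norm_smul_eq hK
    exact ⟨F, WeightedBergman.isIsometricMultiplier_iff_isInner.1 hF,
      WeightedBergman.seriesSet_generated_mulLeft hF _⟩
  · rintro ⟨F, hF, rfl⟩
    have hF := WeightedBergman.isIsometricMultiplier_iff_isInner.2 hF
    refine ⟨_, (WeightedBergman.unitarilyEquivalent_generated_bergmanPart γ).trans
      (WeightedBergman.unitarilyEquivalent_generated_image hF.mulLeft _), ?_⟩
    rw [Set.image_singleton]
    exact WeightedBergman.seriesSet_generated_mulLeft hF _
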